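/- Graphs are finite CW complexes of dimension at most $1$ (loops and multiple edges allowed). For $g\ge 0$ let $\mathcal{G}_g$ be the category whose objects are the non-empty connected graphs of genus $g$ (number of edges minus number of vertices plus one) and whose morphisms are contractions: maps sending vertices to vertices and each edge either onto an edge or to a vertex, taken up to homotopy through such maps, which are surjective with contractible fibres. Let $k$ be a field. A $\mathcal{G}_g^{\mathrm{op}}$-module is a functor $M$ from $\mathcal{G}_g^{\mathrm{op}}$ to $k$-vector spaces. For an object $G$ let $P_G$ be the module $G'\mapsto k\langle \operatorname{Mor}_{\mathcal{G}_g}(G',G)\rangle$. A module is finitely generated in degrees $\le d$ if it is a quotient of a finite direct sum of modules $P_{G_i}$ where each $G_i$ has at most $d$ edges; it is $d$-small if it is a subquotient of a module that is finitely generated in degrees $\le d$; and it is $d$-smallish if it admits an (exhaustive and separated) filtration by submodules whose associated graded module is $d$-small. Let $M$ be a $d$-smallish $\mathcal{G}_g^{\mathrm{op}}$-module, let $G$ be a graph of genus $g$, and let $r\ge 0$. (1) Let $\underline{e}=(e_1,\dots,e_r)$ be directed non-loop edges of $G$ whose underlying edges are pairwise distinct. For positive integers $m_1,\dots,m_r$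 let $G(\underline{e},\underline{m})$ be the graph obtained from $G$ by subdividing each $e_i$ into $m_i$ edges. Then there is a polynomial $f\in\mathbb{Q}[t_1,\dots,t_r]$ of total degree at most $d$ such that, whenever all $m_i$ are sufficiently large, $M(G(\underline{e},\underline{m}))$ is finite-dimensional and $\dim_k M(G(\underline{e},\underline{m})) = f(m_1,\dots,m_r)$. (2) Let $\underline{v}=(v_1,\dots,v_r)$ be distinct vertices of $G$. For natural numbers $m_1,\dots,m_r$ let $G(\underline{v},\underline{m})$ be the graph obtained from $G$ by attaching, for each $i$, $m_i$ new edges to $v_i$, each with a new leaf as its other endpoint. Then there is a polynomial $f\in\mathbb{Q}[t_1,\dots,t_r]$ of total degree at most $d$ such that, whenever all $m_i$ are sufficiently large, $M(G(\underline{v},\underline{m}))$ is finite-dimensional and $\dim_k M(G(\underline{v},\underline{m})) = f(m_1,\dots,m_r)$. -/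

import Mathlib

open CategoryTheory CategoryTheory.Limits Opposite

universe u

/-- A finite graph (a finite CW complex of dimension at most 1), possibly with loops and multiple
edges, described combinatorially: a finite set of vertices and a finite set of directed edges
(each edge being an unordered pair `{d, rev d}` of opposite directed edges; a loop still has two
directions), together with the initial vertex of each directed edge. -/
structure CWGraph where
  Vert : Type
  Dart : Type
  finVert : Finite Vert
  finDart : Finite Dart
  rev : Dart → Dart
  src : Dart → Vert
  rev_rev : ∀ d, rev (rev d) = d
  rev_ne : ∀ d, rev d ≠ d

namespace CWGraph

attribute [instance] CWGraph.finVert CWGraph.finDart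

/-- The terminal vertex of a directed edge. -/
def tgt (G : CWGraph) (d : G.Dart) : G.Vert := G.src (G.rev d)

/-- The number of edges, each edge consisting of exactly two directed edges. -/
noncomputable def numEdges (G : CWGraph) : ℕ := Nat.card G.Dart / 2

/-- `u` and `v` are joined by an edge. -/
def Adj (G : CWGraph) (u v : G.Vert) : Prop := ∃ d, G.src d = u ∧ G.tgt d = v

/-- The graph is non-empty and connected. -/
def Connected (G : CWGraph) : Prop :=
  Nonempty G.Vert ∧ ∀ u v, Relation.ReflTransGen G.Adj u v

/-- The genus of a (non-empty connected) graph: edges minus vertices plus one. -/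
noncomputable def genus (G : CWGraph) : ℤ := (G.numEdges : ℤ) - (Nat.card G.Vert : ℤ) + 1

/-- `G` is a graph of genus `g`; this includes being non-empty and connected. -/
def HasGenus (G : CWGraph) (g : ℕ) : Prop := G.Connected ∧ G.genus = g

/-- A tree is a graph of genus 0, i.e. a contractible graph. -/
def IsTree (G : CWGraph) : Prop := G.HasGenus 0

theorem two_mul_numEdges (G : CWGraph) : 2 * G.numEdges = Nat.card G.Dart := by
  classical
  have := Fintype.ofFinite G.Dart
  have h : 2 ∣ (Function.Involutive.toPerm G.rev G.rev_rev).support.card :=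
    Equiv.Perm.two_dvd_card_support (by
      ext d
      exact G.rev_rev d)
  have h' : (Function.Involutive.toPerm G.rev G.rev_rev).support = Finset.univ := by
    ext d
    exact ⟨fun _ => Finset.mem_univ d, fun _ => Equiv.Perm.mem_support.2 (G.rev_ne d)⟩
  rw [h', Finset.card_univ, ← Nat.card_eq_fintype_card] at h
  unfold numEdges
  omega

/-- A graph morphism: vertices go to vertices, and every directed edge is either contracted to a
vertex (value `none`) or sent to a directed edge. This is the combinatorial form of a very cellular
map up to homotopy through very cellular maps. -/
@[ext]
structure Hom (G H : CWGraph) where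
  onVert : G.Vert → H.Vert
  onDart : G.Dart → Option H.Dart
  onDart_rev : ∀ d, onDart (G.rev d) = (onDart d).map H.rev
  src_onDart : ∀ d d', onDart d = some d' → H.src d' = onVert (G.src d)
  contracted : ∀ d, onDart d = none → onVert (G.src d) = onVert (G.tgt d)

namespace Hom

variable {G H K : CWGraph}

theorem onDart_rev_none (φ : Hom G H) {d : G.Dart} (h : φ.onDart d = none) :
    φ.onDart (G.rev d) = none := by
  rw [φ.onDart_rev, h]; rfl

theorem onDart_rev_some (φ : Hom G H) {d : G.Dart} {d' : H.Dart} (h : φ.onDart d = some d') :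
    φ.onDart (G.rev d) = some (H.rev d') := by
  rw [φ.onDart_rev, h]; rfl

theorem tgt_onDart (φ : Hom G H) {d : G.Dart} {d' : H.Dart} (h : φ.onDart d = some d') :
    H.tgt d' = φ.onVert (G.tgt d) :=
  φ.src_onDart _ _ (φ.onDart_rev_some h)

/-- The fibre of a graph morphism over a vertex `w`: the vertices sent to `w`, together with the
edges contracted to `w`. -/
def fiber (φ : Hom G H) (w : H.Vert) : CWGraph where
  Vert := {v : G.Vert // φ.onVert v = w}
  Dart := {d : G.Dart // φ.onDart d = none ∧ φ.onVert (G.src d) = w}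
  finVert := inferInstance
  finDart := inferInstance
  rev d := ⟨G.rev d.1, φ.onDart_rev_none d.2.1, (φ.contracted _ d.2.1).symm.trans d.2.2⟩
  src d := ⟨G.src d.1, d.2.2⟩
  rev_rev d := Subtype.ext (G.rev_rev d.1)
  rev_ne d h := G.rev_ne d.1 (congrArg Subtype.val h)

/-- A contraction: a graph morphism all of whose fibres are non-empty and contractible. The fibre
over a vertex must be a tree; the fibre over an interior point of an edge is a finite discrete set,
in bijection with the edges sent onto that edge, so it must be a single point. -/
def IsContraction (φ : Hom G H) : Prop :=
  (∀ w, (φ.fiber w).IsTree) ∧ ∀ d', ∃! d, φ.onDart d = some d'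

/-- The identity morphism. -/
def id (G : CWGraph) : Hom G G where
  onVert v := v
  onDart d := some d
  onDart_rev _ := rfl
  src_onDart d d' h := by cases h; rfl
  contracted d h := by cases h

/-- Composition of graph morphisms, in diagrammatic order. -/
def comp (φ : Hom G H) (ψ : Hom H K) : Hom G K where
  onVert v := ψ.onVert (φ.onVert v)
  onDart d := (φ.onDart d).bind ψ.onDart
  onDart_rev d := by
    cases h : φ.onDart d with
    | none => rw [φ.onDart_rev_none h]; rfl
    | some d' => rw [φ.onDart_rev_some h]; exact ψ.onDart_rev d'
  src_onDart d d'' h := by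
    cases hd : φ.onDart d with
    | none => rw [hd] at h; cases h
    | some d' =>
      rw [hd] at h
      rw [← φ.src_onDart d d' hd]
      exact ψ.src_onDart d' d'' h
  contracted d h := by
    cases hd : φ.onDart d with
    | none => exact congrArg ψ.onVert (φ.contracted d hd)
    | some d' =>
      rw [hd] at h
      rw [← φ.src_onDart d d' hd, ← φ.tgt_onDart hd]
      exact ψ.contracted d' h

theorem comp_none_of_none (φ : Hom G H) (ψ : Hom H K) {d : G.Dart} (h : φ.onDart d = none) :
    (φ.comp ψ).onDart d = none := by
  change (φ.onDart d).bind ψ.onDart = none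
  rw [h]; rfl

theorem comp_of_some (φ : Hom G H) (ψ : Hom H K) {d : G.Dart} {d' : H.Dart}
    (h : φ.onDart d = some d') : (φ.comp ψ).onDart d = ψ.onDart d' := by
  change (φ.onDart d).bind ψ.onDart = _
  rw [h]; rfl

theorem isContraction_id (G : CWGraph) : (Hom.id G).IsContraction := by
  refine ⟨fun w => ?_, fun d => ⟨d, rfl, fun d' h => Option.some.inj h⟩⟩
  have hV : Nat.card ((Hom.id G).fiber w).Vert = 1 :=
    Nat.card_eq_one_iff_unique.2 ⟨⟨fun a b => Subtype.ext (a.2.trans b.2.symm)⟩, ⟨⟨w, rfl⟩⟩⟩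
  have hD : Nat.card ((Hom.id G).fiber w).Dart = 0 := by
    have : IsEmpty ((Hom.id G).fiber w).Dart := ⟨fun d => by cases d.2.1⟩
    exact Nat.card_of_isEmpty
  refine ⟨⟨⟨⟨w, rfl⟩⟩, fun u v => ?_⟩, ?_⟩
  · have : u = v := Subtype.ext (u.2.trans v.2.symm)
    rw [this]
  · simp [genus, numEdges, hV, hD]

/-- Two vertices with the same image under a contraction `φ` are connected inside the fibre of
`φ.comp ψ`. -/
theorem reach_of_eq {φ : Hom G H} (hφ : φ.IsContraction) (ψ : Hom H K) {w : K.Vert}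
    (a b : ((φ.comp ψ).fiber w).Vert) (h : φ.onVert a.1 = φ.onVert b.1) :
    Relation.ReflTransGen ((φ.comp ψ).fiber w).Adj a b := by
  have key := (hφ.1 (φ.onVert b.1)).1.2 ⟨a.1, h⟩ ⟨b.1, rfl⟩
  have hw : ψ.onVert (φ.onVert b.1) = w := b.2
  refine Relation.ReflTransGen.lift
    (fun x : (φ.fiber (φ.onVert b.1)).Vert =>
      (⟨x.1, (congrArg ψ.onVert x.2).trans hw⟩ : ((φ.comp ψ).fiber w).Vert)) ?_ _ _ key
  rintro x y ⟨d, hx, hy⟩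
  exact ⟨⟨d.1, comp_none_of_none φ ψ d.2.1, (congrArg ψ.onVert d.2.2).trans hw⟩,
    Subtype.ext (congrArg (fun z => z.1) hx), Subtype.ext (congrArg (fun z => z.1) hy)⟩

theorem exists_onVert {φ : Hom G H} (hφ : φ.IsContraction) (v : H.Vert) :
    ∃ u, φ.onVert u = v := by
  obtain ⟨u⟩ := (hφ.1 v).1.1
  exact ⟨u.1, u.2⟩

theorem connected_comp {φ : Hom G H} {ψ : Hom H K} (hφ : φ.IsContraction)
    (hψ : ψ.IsContraction) (w : K.Vert) : ((φ.comp ψ).fiber w).Connected := by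
  constructor
  · obtain ⟨v, hv⟩ := exists_onVert hψ w
    obtain ⟨u, hu⟩ := exists_onVert hφ v
    exact ⟨⟨u, (congrArg ψ.onVert hu).trans hv⟩⟩
  · intro a b
    have key := (hψ.1 w).1.2 ⟨φ.onVert a.1, a.2⟩ ⟨φ.onVert b.1, b.2⟩
    have gen : ∀ y : (ψ.fiber w).Vert,
        Relation.ReflTransGen (ψ.fiber w).Adj ⟨φ.onVert a.1, a.2⟩ y →
        ∀ c : ((φ.comp ψ).fiber w).Vert, φ.onVert c.1 = y.1 →
          Relation.ReflTransGen ((φ.comp ψ).fiber w).Adj a c := by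
      intro y hy
      induction hy with
      | refl => intro c hc; exact reach_of_eq hφ ψ a c hc.symm
      | tail _ hstep ih =>
        intro c hc
        obtain ⟨d', h1, h2⟩ := hstep
        obtain ⟨d, hd, _⟩ := hφ.2 d'.1
        have hnone : (φ.comp ψ).onDart d = none := (comp_of_some φ ψ hd).trans d'.2.1
        have hs : φ.onVert (G.src d) = H.src d'.1 := (φ.src_onDart _ _ hd).symm
        have ht : φ.onVert (G.tgt d) = H.tgt d'.1 := (φ.tgt_onDart hd).symm
        have hsw : (φ.comp ψ).onVert (G.src d) = w := (congrArg ψ.onVert hs).trans d'.2.2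
        have htw : (φ.comp ψ).onVert (G.tgt d) = w :=
          ((φ.comp ψ).contracted d hnone).symm.trans hsw
        have r1 := ih ⟨G.src d, hsw⟩ (hs.trans (congrArg Subtype.val h1))
        have r2 : ((φ.comp ψ).fiber w).Adj ⟨G.src d, hsw⟩ ⟨G.tgt d, htw⟩ :=
          ⟨⟨d, hnone, hsw⟩, rfl, rfl⟩
        have r3 := reach_of_eq hφ ψ (w := w) ⟨G.tgt d, htw⟩ c
          (ht.trans ((congrArg Subtype.val h2).trans hc.symm))
        exact (r1.tail r2).trans r3
    exact gen _ key b rfl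

theorem card_vert_comp (φ : Hom G H) (ψ : Hom H K) (w : K.Vert) :
    Nat.card ((φ.comp ψ).fiber w).Vert =
      Nat.card (Σ v : (ψ.fiber w).Vert, (φ.fiber v.1).Vert) := by
  refine Nat.card_congr ⟨fun u => ⟨⟨φ.onVert u.1, u.2⟩, ⟨u.1, rfl⟩⟩,
    fun x => ⟨x.2.1, (congrArg ψ.onVert x.2.2).trans x.1.2⟩, fun u => rfl, ?_⟩
  rintro ⟨⟨v, hv⟩, ⟨u, hu⟩⟩
  dsimp only at hu
  subst hu
  rfl

theorem card_dart_comp {φ : Hom G H} (hφ : φ.IsContraction) (ψ : Hom H K) (w : K.Vert) :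
    Nat.card ((φ.comp ψ).fiber w).Dart =
      Nat.card ((ψ.fiber w).Dart ⊕ Σ v : (ψ.fiber w).Vert, (φ.fiber v.1).Dart) := by
  choose s hs hs' using hφ.2
  symm
  refine Nat.card_eq_of_bijective (fun x => Sum.elim
    (fun d' : (ψ.fiber w).Dart => (⟨s d'.1, (comp_of_some φ ψ (hs d'.1)).trans d'.2.1,
      (congrArg ψ.onVert (φ.src_onDart _ _ (hs d'.1)).symm).trans d'.2.2⟩ :
      ((φ.comp ψ).fiber w).Dart))
    (fun y : Σ v : (ψ.fiber w).Vert, (φ.fiber v.1).Dart =>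
      (⟨y.2.1, comp_none_of_none φ ψ y.2.2.1,
        (congrArg ψ.onVert y.2.2.2).trans y.1.2⟩ : ((φ.comp ψ).fiber w).Dart)) x) ⟨?_, ?_⟩
  · rintro (⟨a, ha⟩ | ⟨⟨v, hv⟩, ⟨a, ha, ha'⟩⟩) (⟨b, hb⟩ | ⟨⟨v', hv'⟩, ⟨b, hb, hb'⟩⟩) hab
    · have h : s a = s b := congrArg Subtype.val hab
      have h2 := hs a
      rw [h, hs b] at h2
      cases h2
      rfl
    · have h : s a = b := congrArg Subtype.val hab
      have h2 := hs a
      rw [h, hb] at h2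
      cases h2
    · have h : a = s b := congrArg Subtype.val hab
      have h2 := hs b
      rw [← h, ha] at h2
      cases h2
    · have h : a = b := congrArg Subtype.val hab
      subst h
      dsimp only at ha' hb'
      subst ha'
      subst hb'
      rfl
  · rintro ⟨d, hd, hw⟩
    cases h : φ.onDart d with
    | none => exact ⟨Sum.inr ⟨⟨φ.onVert (G.src d), hw⟩, ⟨d, h, rfl⟩⟩, rfl⟩
    | some d' =>
      refine ⟨Sum.inl ⟨d', (comp_of_some φ ψ h).symm.trans hd,
        (congrArg ψ.onVert (φ.src_onDart _ _ h)).trans hw⟩, Subtype.ext (hs' d' d h).symm⟩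

theorem IsTree.card_dart {T : CWGraph} (h : T.IsTree) :
    Nat.card T.Dart + 2 = 2 * Nat.card T.Vert := by
  have h1 := T.two_mul_numEdges
  have h2 : (T.numEdges : ℤ) - (Nat.card T.Vert : ℤ) + 1 = ((0 : ℕ) : ℤ) := h.2
  omega

theorem isContraction_comp {φ : Hom G H} {ψ : Hom H K} (hφ : φ.IsContraction)
    (hψ : ψ.IsContraction) : (φ.comp ψ).IsContraction := by
  classical
  refine ⟨fun w => ⟨connected_comp hφ hψ w, ?_⟩, fun d'' => ?_⟩
  · have := Fintype.ofFinite (ψ.fiber w).Vert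
    have hV := card_vert_comp φ ψ w
    have hD := card_dart_comp hφ ψ w
    rw [Nat.card_sigma] at hV
    rw [Nat.card_sum, Nat.card_sigma] at hD
    have hT := IsTree.card_dart (hψ.1 w)
    have hS : ∑ v : (ψ.fiber w).Vert, (Nat.card (φ.fiber v.1).Dart + 2) =
        ∑ v : (ψ.fiber w).Vert, 2 * Nat.card (φ.fiber v.1).Vert :=
      Finset.sum_congr rfl fun v _ => IsTree.card_dart (hφ.1 v.1)
    rw [Finset.sum_add_distrib, ← Finset.mul_sum, Finset.sum_const, Finset.card_univ,
      ← Nat.card_eq_fintype_card, smul_eq_mul] at hS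
    have h2 := ((φ.comp ψ).fiber w).two_mul_numEdges
    unfold genus
    push_cast
    omega
  · obtain ⟨d', hd', hu'⟩ := hψ.2 d''
    obtain ⟨d, hd, hu⟩ := hφ.2 d'
    refine ⟨d, (comp_of_some φ ψ hd).trans hd', fun x hx => ?_⟩
    dsimp only at hx
    cases h : φ.onDart x with
    | none =>
      rw [comp_none_of_none φ ψ h] at hx
      cases hx
    | some x' =>
      have h' := (comp_of_some φ ψ h).symm.trans hx
      have := hu' x' h'
      subst this
      exact hu x h

end Hom

/-- The directed edges `e 0, …, e (r-1)` lie on pairwise distinct edges. -/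
def DistinctEdges (G : CWGraph) {r : ℕ} (e : Fin r → G.Dart) : Prop :=
  ∀ i j, i ≠ j → e i ≠ e j ∧ e i ≠ G.rev (e j)

/-- The directed edges that do not lie on any of the edges `e i`. -/
def Untouched (G : CWGraph) {r : ℕ} (e : Fin r → G.Dart) (d : G.Dart) : Prop :=
  ∀ i, d ≠ e i ∧ d ≠ G.rev (e i)

/-- The `t`-th vertex (for `0 ≤ t ≤ m i`) on the directed path of length `m i` which replaces
`e i`: it is the origin of `e i` for `t = 0`, the terminus of `e i` for `t = m i`, and one of the
`m i - 1` new vertices otherwise. -/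
def pathVert (G : CWGraph) {r : ℕ} (e : Fin r → G.Dart) (m : Fin r → ℕ+) (i : Fin r) (t : ℕ) :
    G.Vert ⊕ (Σ i : Fin r, Fin ((m i : ℕ) - 1)) :=
  if t = 0 then Sum.inl (G.src (e i))
  else if h : t - 1 < (m i : ℕ) - 1 then Sum.inr ⟨i, ⟨t - 1, h⟩⟩
  else Sum.inl (G.tgt (e i))

/-- The graph obtained from `G` by replacing each edge `e i` by a path of `m i` edges. The `j`-th
edge of the `i`-th path is `(⟨i, j⟩, true)` in forward and `(⟨i, j⟩, false)` in backward
direction. -/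
def subdivide (G : CWGraph) {r : ℕ} (e : Fin r → G.Dart) (m : Fin r → ℕ+) : CWGraph where
  Vert := G.Vert ⊕ (Σ i : Fin r, Fin ((m i : ℕ) - 1))
  Dart := {d : G.Dart // G.Untouched e d} ⊕ ((Σ i : Fin r, Fin (m i : ℕ)) × Bool)
  finVert := inferInstance
  finDart := inferInstance
  rev := Sum.map
    (fun d => ⟨G.rev d.1, fun i =>
      ⟨fun h => (d.2 i).2 (by rw [← h, G.rev_rev]),
       fun h => (d.2 i).1 (by rw [← G.rev_rev d.1, h, G.rev_rev])⟩⟩)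
    (fun x => (x.1, !x.2))
  src := Sum.elim (fun d => Sum.inl (G.src d.1))
    (fun x => G.pathVert e m x.1.1 (if x.2 then (x.1.2 : ℕ) else (x.1.2 : ℕ) + 1))
  rev_rev := by
    rintro (d | ⟨x, b⟩)
    · exact congrArg Sum.inl (Subtype.ext (G.rev_rev d.1))
    · simp
  rev_ne := by
    rintro (d | ⟨x, b⟩) h
    · exact G.rev_ne d.1 (congrArg Subtype.val (Sum.inl.inj h))
    · simp at h

/-- The graph obtained from `G` by attaching, for each `i`, `m i` new edges to the vertex `v i`,
each with a new leaf as its other endpoint. -/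
def sprout (G : CWGraph) {r : ℕ} (v : Fin r → G.Vert) (m : Fin r → ℕ) : CWGraph where
  Vert := G.Vert ⊕ (Σ i : Fin r, Fin (m i))
  Dart := G.Dart ⊕ ((Σ i : Fin r, Fin (m i)) × Bool)
  finVert := inferInstance
  finDart := inferInstance
  rev := Sum.map G.rev (fun x => (x.1, !x.2))
  src := Sum.elim (fun d => Sum.inl (G.src d))
    (fun x => if x.2 then Sum.inl (v x.1.1) else Sum.inr x.1)
  rev_rev := by
    rintro (d | ⟨x, b⟩)
    · exact congrArg Sum.inl (G.rev_rev d)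
    · simp
  rev_ne := by
    rintro (d | ⟨x, b⟩) h
    · exact G.rev_ne d (Sum.inl.inj h)
    · simp at h

theorem Adj.symm {G : CWGraph} {u v : G.Vert} (h : G.Adj u v) : G.Adj v u := by
  obtain ⟨d, rfl, rfl⟩ := h
  exact ⟨G.rev d, rfl, congrArg G.src (G.rev_rev d)⟩

theorem reach_symm {G : CWGraph} {u v : G.Vert} (h : Relation.ReflTransGen G.Adj u v) :
    Relation.ReflTransGen G.Adj v u := by
  induction h with
  | refl => exact .refl
  | tail _ hs ih => exact .head hs.symm ih

theorem connected_of_reach {G : CWGraph} (c : G.Vert)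
    (h : ∀ v, Relation.ReflTransGen G.Adj c v) : G.Connected :=
  ⟨⟨c⟩, fun u v => (reach_symm (h u)).trans (h v)⟩

theorem card_untouched (G : CWGraph) {r : ℕ} (e : Fin r → G.Dart) (he : G.DistinctEdges e) :
    Nat.card {d : G.Dart // G.Untouched e d} + 2 * r = Nat.card G.Dart := by
  classical
  have h1 : Nat.card {d : G.Dart // ¬ G.Untouched e d} = Nat.card (Fin r × Bool) := by
    symm
    refine Nat.card_eq_of_bijective
      (fun x => ⟨if x.2 then e x.1 else G.rev (e x.1), fun h => ?_⟩) ⟨?_, ?_⟩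
    · rcases x with ⟨i, b⟩
      cases b
      · exact (h i).2 rfl
      · exact (h i).1 rfl
    · have hinj : ∀ i j, e i = e j → i = j := fun i j h => by
        by_contra hij
        exact (he i j hij).1 h
      have hne : ∀ i j, e i ≠ G.rev (e j) := fun i j h => by
        by_cases hij : i = j
        · subst hij
          exact G.rev_ne _ h.symm
        · exact (he i j hij).2 h
      rintro ⟨i, b⟩ ⟨j, c⟩ h
      have h := congrArg Subtype.val h
      cases b <;> cases c <;> simp only [if_true, Bool.false_eq_true, if_false] at h
      · have := congrArg G.rev h
        rw [G.rev_rev, G.rev_rev] at this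
        rw [hinj i j this]
      · exact absurd h.symm (hne j i)
      · exact absurd h (hne i j)
      · rw [hinj i j h]
    · rintro ⟨d, hd⟩
      unfold Untouched at hd
      push Not at hd
      obtain ⟨i, hi⟩ := hd
      by_cases h : d = e i
      · exact ⟨(i, true), Subtype.ext h.symm⟩
      · exact ⟨(i, false), Subtype.ext (hi h).symm⟩
  have h2 := Nat.card_congr (Equiv.sumCompl (fun d => G.Untouched e d))
  rw [Nat.card_sum, h1, Nat.card_prod, Nat.card_eq_fintype_card (α := Fin r),
    Nat.card_eq_fintype_card (α := Bool), Fintype.card_fin, Fintype.card_bool] at h2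
  omega

theorem pathVert_zero (G : CWGraph) {r : ℕ} (e : Fin r → G.Dart) (m : Fin r → ℕ+) (i : Fin r) :
    G.pathVert e m i 0 = Sum.inl (G.src (e i)) := rfl

theorem pathVert_last (G : CWGraph) {r : ℕ} (e : Fin r → G.Dart) (m : Fin r → ℕ+) (i : Fin r) :
    G.pathVert e m i (m i) = Sum.inl (G.tgt (e i)) := by
  unfold pathVert
  rw [if_neg (m i).pos.ne', dif_neg (lt_irrefl _)]

theorem pathVert_succ (G : CWGraph) {r : ℕ} (e : Fin r → G.Dart) (m : Fin r → ℕ+) (i : Fin r)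
    (t : Fin ((m i : ℕ) - 1)) : G.pathVert e m i (t + 1) = Sum.inr ⟨i, t⟩ := by
  unfold pathVert
  rw [if_neg (Nat.succ_ne_zero _), dif_pos (show (t : ℕ) + 1 - 1 < (m i : ℕ) - 1 from t.2)]
  rfl

theorem reach_pathVert (G : CWGraph) {r : ℕ} (e : Fin r → G.Dart) (m : Fin r → ℕ+) (i : Fin r)
    (t : ℕ) (ht : t ≤ m i) :
    Relation.ReflTransGen (G.subdivide e m).Adj (Sum.inl (G.src (e i))) (G.pathVert e m i t) := by
  induction t with
  | zero => exact .refl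
  | succ t ih =>
    exact (ih (by omega)).tail ⟨Sum.inr (⟨i, ⟨t, by omega⟩⟩, true), rfl, rfl⟩

theorem HasGenus.subdivide {G : CWGraph} {g : ℕ} (hG : G.HasGenus g) {r : ℕ} {e : Fin r → G.Dart}
    (he : G.DistinctEdges e) (m : Fin r → ℕ+) : (G.subdivide e m).HasGenus g := by
  obtain ⟨⟨⟨c⟩, hc⟩, hg⟩ := hG
  have hin : ∀ v : G.Vert,
      Relation.ReflTransGen (G.subdivide e m).Adj (Sum.inl c) (Sum.inl v) := by
    intro v
    have := hc c v
    induction this with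
    | refl => exact .refl
    | tail _ hs ih =>
      refine ih.trans ?_
      obtain ⟨d, rfl, rfl⟩ := hs
      have hlast : ∀ i, Relation.ReflTransGen (G.subdivide e m).Adj
          (Sum.inl (G.src (e i))) (Sum.inl (G.tgt (e i))) := fun i => by
        have := G.reach_pathVert e m i (m i) le_rfl
        rwa [pathVert_last] at this
      by_cases hd : G.Untouched e d
      · exact .single ⟨Sum.inl ⟨d, hd⟩, rfl, rfl⟩
      · unfold Untouched at hd
        push Not at hd
        obtain ⟨i, hi⟩ := hd
        by_cases h : d = e i
        · rw [h]
          exact hlast i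
        · have h2 : G.tgt (G.rev (e i)) = G.src (e i) := congrArg G.src (G.rev_rev _)
          rw [hi h, h2]
          exact reach_symm (hlast i)
  refine ⟨connected_of_reach (Sum.inl c) ?_, ?_⟩
  · rintro (v | ⟨i, t⟩)
    · exact hin v
    · have := G.reach_pathVert e m i (t + 1) (by omega)
      rw [pathVert_succ] at this
      exact (hin _).trans this
  · have hD : Nat.card (G.subdivide e m).Dart =
        Nat.card {d : G.Dart // G.Untouched e d} + (∑ i, (m i : ℕ)) * 2 := by
      change Nat.card ({d : G.Dart // G.Untouched e d} ⊕ ((Σ i : Fin r, Fin (m i : ℕ)) × Bool)) = _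
      simp
    have hV : Nat.card (G.subdivide e m).Vert = Nat.card G.Vert + ∑ i, ((m i : ℕ) - 1) := by
      change Nat.card (G.Vert ⊕ (Σ i : Fin r, Fin ((m i : ℕ) - 1))) = _
      simp
    have hS : ∑ i, (m i : ℕ) = ∑ i, ((m i : ℕ) - 1) + r := by
      have : ∑ i, (m i : ℕ) = ∑ i, (((m i : ℕ) - 1) + 1) :=
        Finset.sum_congr rfl fun i _ => (Nat.sub_add_cancel (m i).pos).symm
      rw [this, Finset.sum_add_distrib]
      simp
    have h1 := G.card_untouched e he
    have h2 := G.two_mul_numEdges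
    have h3 := (G.subdivide e m).two_mul_numEdges
    unfold genus at hg ⊢
    omega

theorem HasGenus.sprout {G : CWGraph} {g : ℕ} (hG : G.HasGenus g) {r : ℕ} (v : Fin r → G.Vert)
    (m : Fin r → ℕ) : (G.sprout v m).HasGenus g := by
  obtain ⟨⟨⟨c⟩, hc⟩, hg⟩ := hG
  have hin : ∀ v' : G.Vert,
      Relation.ReflTransGen (G.sprout v m).Adj (Sum.inl c) (Sum.inl v') := by
    intro v'
    have := hc c v'
    induction this with
    | refl => exact .refl
    | tail _ hs ih =>
      obtain ⟨d, rfl, rfl⟩ := hs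
      exact ih.tail ⟨Sum.inl d, rfl, rfl⟩
  refine ⟨connected_of_reach (Sum.inl c) ?_, ?_⟩
  · rintro (v' | x)
    · exact hin v'
    · exact (hin (v x.1)).tail ⟨Sum.inr (x, true), rfl, rfl⟩
  · have hD : Nat.card (G.sprout v m).Dart = Nat.card G.Dart + (∑ i, m i) * 2 := by
      change Nat.card (G.Dart ⊕ ((Σ i : Fin r, Fin (m i)) × Bool)) = _
      simp
    have hV : Nat.card (G.sprout v m).Vert = Nat.card G.Vert + ∑ i, m i := by
      change Nat.card (G.Vert ⊕ (Σ i : Fin r, Fin (m i))) = _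
      simp
    have h2 := G.two_mul_numEdges
    have h3 := (G.sprout v m).two_mul_numEdges
    unfold genus at hg ⊢
    omega

end CWGraph

/-- The objects of the category of graphs of genus `g`. -/
structure GenusGraph (g : ℕ) where
  graph : CWGraph
  hasGenus : graph.HasGenus g

/-- The morphisms of the category of graphs of genus `g`: contractions. -/
@[ext]
structure GenusGraph.Contraction {g : ℕ} (G H : GenusGraph g) where
  hom : CWGraph.Hom G.graph H.graph
  isContraction : hom.IsContraction

/-- The category of graphs of genus `g` with contractions as morphisms. -/
instance GenusGraph.category (g : ℕ) : Category (GenusGraph g) where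
  Hom G H := GenusGraph.Contraction G H
  id G := ⟨CWGraph.Hom.id G.graph, CWGraph.Hom.isContraction_id G.graph⟩
  comp φ ψ := ⟨φ.hom.comp ψ.hom, CWGraph.Hom.isContraction_comp φ.isContraction ψ.isContraction⟩
  id_comp _ := rfl
  comp_id φ := GenusGraph.Contraction.ext
    (CWGraph.Hom.ext rfl (funext fun d => Option.bind_fun_some (φ.hom.onDart d)))
  assoc φ _ _ := GenusGraph.Contraction.ext
    (CWGraph.Hom.ext rfl (funext fun d => Option.bind_assoc (φ.hom.onDart d) _ _))

/-- Subdivision, as an operation on graphs of genus `g`. -/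
def GenusGraph.subdivide {g : ℕ} (G : GenusGraph g) {r : ℕ} (e : Fin r → G.graph.Dart)
    (he : G.graph.DistinctEdges e) (m : Fin r → ℕ+) : GenusGraph g :=
  ⟨G.graph.subdivide e m, G.hasGenus.subdivide he m⟩

/-- Sprouting, as an operation on graphs of genus `g`. -/
def GenusGraph.sprout {g : ℕ} (G : GenusGraph g) {r : ℕ} (v : Fin r → G.graph.Vert)
    (m : Fin r → ℕ) : GenusGraph g :=
  ⟨G.graph.sprout v m, G.hasGenus.sprout v m⟩

/-- Modules over the opposite of the category of graphs of genus `g`: functors from that opposite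
category to `k`-modules. -/
abbrev GraphModule (k : Type u) [CommRing k] (g : ℕ) := (GenusGraph g)ᵒᵖ ⥤ ModuleCat.{u} k

namespace GraphModule

variable {k : Type u} [CommRing k] {g : ℕ}

/-- The principal projective `P_G`, sending `H` to the free module on the set of contractions
`H ⟶ G`. -/
noncomputable def principal (k : Type u) [CommRing k] {g : ℕ} (G : GenusGraph g) :
    GraphModule k g where
  obj H := ModuleCat.of k ((H.unop ⟶ G) →₀ k)
  map f := ModuleCat.ofHom (Finsupp.lmapDomain k k (fun φ => f.unop ≫ φ))
  map_id H := by
    ext φ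
    simp
  map_comp f h := by
    ext φ
    simp

/-- `M` is finitely generated in degrees `≤ d`: it is a quotient of a finite direct sum of principal
projectives of graphs with at most `d` edges. -/
def IsFGInDegreeLE (M : GraphModule k g) (d : ℕ) : Prop :=
  ∃ (n : ℕ) (X : Fin n → GenusGraph g), (∀ i, (X i).graph.numEdges ≤ d) ∧
    ∃ p : (∐ fun i => principal k (X i)) ⟶ M, Epi p

/-- `M` is `d`-small: it is a subquotient (a quotient of a submodule) of a module which is finitely
generated in degrees `≤ d`. -/
def IsSmall (M : GraphModule k g) (d : ℕ) : Prop :=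
  ∃ (N S : GraphModule k g) (i : S ⟶ N) (p : S ⟶ M), N.IsFGInDegreeLE d ∧ Mono i ∧ Epi p

/-- A filtration of `M`: an increasing `ℤ`-indexed family of submodules, which is exhaustive and
separated. (Every finite filtration is an instance.) -/
structure Filtration (M : GraphModule k g) where
  F : ℤ → Subobject M
  mono : Monotone F
  exhaustive : ∀ (X : (GenusGraph g)ᵒᵖ) (x : M.obj X), ∃ i, ∃ y, (F i).arrow.app X y = x
  separated : ∀ (X : (GenusGraph g)ᵒᵖ) (x : M.obj X), (∀ i, ∃ y, (F i).arrow.app X y = x) → x = 0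

/-- The associated graded module, the direct sum of the quotients `F i / F (i - 1)`. -/
noncomputable def Filtration.gr {M : GraphModule k g} (F : Filtration M) : GraphModule k g :=
  ∐ fun i : ℤ => cokernel (Subobject.ofLE (F.F (i - 1)) (F.F i) (F.mono (by omega)))

/-- `M` is `d`-smallish: it admits a filtration whose associated graded module is `d`-small. -/
def IsSmallish (M : GraphModule k g) (d : ℕ) : Prop :=
  ∃ F : Filtration M, F.gr.IsSmall d

end GraphModule

/-! The argument is of Gröbner type. Evaluation at a graph is exact, so a smallish module has the
dimensions of its associated graded module. That module is a subquotient of a sum of principal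
projectives `P_Y`, where each `Y` has at most `d` edges. Hence `dim M(H)` is the difference of the
dimensions of two subspaces of the free space on all contractions `H ⟶ Y i`, and both subspaces are
stable under pullback along contractions (`IsSmallish.exists_submodules`). It suffices to treat one
stable family of subspaces.

Both constructions in the theorem give graphs with a fixed part and `r` ordered blocks of edges,
whose places are called slots (`GraphFamily`). A contraction to `Y` sends exactly one edge onto each
edge of `Y`, so at most `d` slots are not contracted. It is therefore determined by that set of
slots together with a label from a finite set: its values on the fixed part, and the word of images
of the surviving slots in their order. Pulling back along the contraction of one block edge keeps
the label and shifts the surviving slots, as if an empty slot had been inserted.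

Insertion is strictly increasing for the lexicographic order on slots, hence for the colexicographic
order on finite sets of slots, so it carries leading exponents to leading exponents
(`mem_leadingExponents_of_strictMono`). The dimension of a subspace is the number of its leading
exponents (`finrank_eq_ncard_leadingExponents`). What remains is to count families of at most `d`
slots that are closed under insertion.

A set with `s i` slots in block `i` is encoded by `s i + 1` gaps in that block, and an insertion
enlarges one gap by one. Closed families thus become upper sets in a product of copies of the
natural numbers, counted with prescribed block sums. By Dickson's lemma such an upper set is a
finite union of cones. Inclusion-exclusion then reduces the count to single cones, where it is a
product of binomial coefficients of total degree `∑ i, s i ≤ d` (`eventuallyPolynomial_upperSet`).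
-/

/-! ### Eventually polynomial functions -/

/-- A function of `r` natural numbers which agrees, when all arguments are large, with a polynomial
of total degree at most `d`. -/
def EventuallyPolynomial {r : ℕ} (d : ℕ) (F : (Fin r → ℕ) → ℚ) : Prop :=
  ∃ f : MvPolynomial (Fin r) ℚ, f.totalDegree ≤ d ∧ ∃ N : ℕ, ∀ n : Fin r → ℕ, (∀ i, N ≤ n i) →
    F n = MvPolynomial.eval (fun i => (n i : ℚ)) f

namespace EventuallyPolynomial

variable {r d : ℕ} {F F' : (Fin r → ℕ) → ℚ}

theorem mono {d' : ℕ} (h : EventuallyPolynomial d F) (hd : d ≤ d') :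
    EventuallyPolynomial d' F := by
  obtain ⟨f, hf, h⟩ := h
  exact ⟨f, hf.trans hd, h⟩

theorem congr' (h : EventuallyPolynomial d F) (N : ℕ)
    (hN : ∀ n : Fin r → ℕ, (∀ i, N ≤ n i) → F' n = F n) : EventuallyPolynomial d F' := by
  obtain ⟨f, hf, M, hM⟩ := h
  exact ⟨f, hf, max N M, fun n hn => (hN n fun i => (le_max_left _ _).trans (hn i)).trans
    (hM n fun i => (le_max_right _ _).trans (hn i))⟩

theorem zero : EventuallyPolynomial d (fun _ : Fin r → ℕ => 0) :=
  ⟨0, by simp, 0, fun n _ => by simp⟩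

theorem const_mul (h : EventuallyPolynomial d F) (c : ℚ) :
    EventuallyPolynomial d (fun n => c * F n) := by
  obtain ⟨f, hf, M, hM⟩ := h
  refine ⟨MvPolynomial.C c * f, (MvPolynomial.totalDegree_mul _ _).trans (by simpa using hf), M,
    fun n hn => ?_⟩
  simp [hM n hn]

theorem add (h : EventuallyPolynomial d F) (h' : EventuallyPolynomial d F') :
    EventuallyPolynomial d (fun n => F n + F' n) := by
  obtain ⟨f, hf, M, hM⟩ := h
  obtain ⟨f', hf', M', hM'⟩ := h'
  refine ⟨f + f', (MvPolynomial.totalDegree_add _ _).trans (max_le hf hf'), max M M',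
    fun n hn => ?_⟩
  simp [hM n fun i => (le_max_left _ _).trans (hn i),
    hM' n fun i => (le_max_right _ _).trans (hn i)]

theorem sub (h : EventuallyPolynomial d F) (h' : EventuallyPolynomial d F') :
    EventuallyPolynomial d (fun n => F n - F' n) := by
  simpa [sub_eq_add_neg] using h.add (h'.const_mul (-1))

theorem sum {ι : Type*} (s : Finset ι) {F : ι → (Fin r → ℕ) → ℚ}
    (h : ∀ i ∈ s, EventuallyPolynomial d (F i)) :
    EventuallyPolynomial d (fun n => ∑ i ∈ s, F i n) := by
  classical
  induction s using Finset.induction_on with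
  | empty => simpa using zero
  | insert a s ha ih =>
    simp only [Finset.sum_insert ha]
    exact (h a (by simp)).add (ih fun i hi => h i (by simp [hi]))

/-- A product of polynomials, one in each variable. -/
theorem prod_polynomial (p : Fin r → Polynomial ℚ) :
    EventuallyPolynomial (∑ i, (p i).natDegree) (fun n => ∏ i, (p i).eval (n i : ℚ)) := by
  refine ⟨∏ i, Polynomial.aeval (MvPolynomial.X i) (p i), ?_, 0, fun n _ => ?_⟩
  · refine (MvPolynomial.totalDegree_finsetProd _ _).trans (Finset.sum_le_sum fun i _ => ?_)
    rw [Polynomial.aeval_eq_sum_range]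
    refine MvPolynomial.totalDegree_finsetSum_le fun j hj => ?_
    refine (MvPolynomial.totalDegree_smul_le _ _).trans ?_
    rw [MvPolynomial.totalDegree_X_pow]
    exact Nat.lt_succ_iff.1 (Finset.mem_range.1 hj)
  · rw [map_prod]
    refine Finset.prod_congr rfl fun i _ => ?_
    rw [← MvPolynomial.coe_aeval_eq_eval, RingHom.coe_coe, ← Polynomial.aeval_algHom_apply]
    simp [Polynomial.aeval_def, Polynomial.eval₂_eq_eval_map]

end EventuallyPolynomial

/-! ### Lattice points of cones and upper sets with given block sums -/

open Finset Classical in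
-- Translation by `b` reduces the count to all vectors of sum `n - ∑ j, b j`, which are multisets of
-- that size on `s + 1` letters (stars and bars).
theorem card_piAntidiag_filter_le {s : ℕ} (b : Fin (s + 1) → ℕ) {n : ℕ} (hn : ∑ j, b j ≤ n) :
    #{a ∈ piAntidiag (univ : Finset (Fin (s + 1))) n | b ≤ a} = (n - ∑ j, b j + s).choose s := by
  have h1 : ({a ∈ piAntidiag (univ : Finset (Fin (s + 1))) n | b ≤ a}) =
      (piAntidiag (univ : Finset (Fin (s + 1))) (n - ∑ j, b j)).map (addRightEmbedding b) := by
    ext a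
    simp only [mem_filter, mem_piAntidiag, mem_univ, implies_true, and_true, mem_map,
      addRightEmbedding_apply]
    constructor
    · rintro ⟨rfl, hb⟩
      refine ⟨a - b, ?_, tsub_add_cancel_of_le hb⟩
      rw [eq_tsub_iff_add_eq_of_le (sum_le_sum fun j _ => hb j), ← sum_add_distrib]
      exact sum_congr rfl fun j _ => tsub_add_cancel_of_le (hb j)
    · rintro ⟨c, hc, rfl⟩
      refine ⟨?_, le_add_of_nonneg_left (fun _ => Nat.zero_le _)⟩
      simp only [Pi.add_apply, sum_add_distrib, hc]
      omega
  have h2 : #(piAntidiag (univ : Finset (Fin (s + 1))) (n - ∑ j, b j)) =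
      Fintype.card (Sym (Fin (s + 1)) (n - ∑ j, b j)) := by
    rw [← Fintype.card_coe]
    refine Fintype.card_congr (Equiv.trans ?_ (Sym.equivNatSumOfFintype _ _).symm)
    exact Equiv.subtypeEquivRight fun a => by simp
  rw [h1, card_map, h2, Sym.card_sym_eq_choose, Fintype.card_fin]
  rw [show s + 1 + (n - ∑ j, b j) - 1 = n - ∑ j, b j + s by omega]
  exact Nat.choose_symm_of_eq_add rfl

open Finset Classical in
/-- The number of vectors above `b` with given block sums. -/
theorem eventuallyPolynomial_cone {r : ℕ} (s : Fin r → ℕ) (b : ∀ i, Fin (s i + 1) → ℕ) :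
    EventuallyPolynomial (∑ i, s i) (fun n : Fin r → ℕ =>
      (#{a ∈ Fintype.piFinset fun i =>
        piAntidiag (univ : Finset (Fin (s i + 1))) (n i - s i) | b ≤ a} : ℚ)) := by
  -- `Polynomial.preHilbertPoly ℚ s c` has degree `s` and takes the value `(n - c + s).choose s` at
  -- each `n ≥ c`. Here `c` is `s i` plus the sum of `b i`, because the block sum is `n i - s i`
  -- rather than `n i`.
  have key := EventuallyPolynomial.prod_polynomial
    (fun i => Polynomial.preHilbertPoly ℚ (s i) (s i + ∑ j, b i j))
  simp only [Polynomial.natDegree_preHilbertPoly] at key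
  refine key.congr' (∑ i, (s i + ∑ j, b i j)) fun n hn => ?_
  have hn' : ∀ i, s i + ∑ j, b i j ≤ n i := fun i =>
    (single_le_sum (f := fun i => s i + ∑ j, b i j) (fun _ _ => Nat.zero_le _) (mem_univ i)).trans
      (hn i)
  have h1 : ({a ∈ Fintype.piFinset fun i =>
        piAntidiag (univ : Finset (Fin (s i + 1))) (n i - s i) | b ≤ a}) =
      Fintype.piFinset fun i =>
        {a ∈ piAntidiag (univ : Finset (Fin (s i + 1))) (n i - s i) | b i ≤ a} := by
    ext a
    simp only [mem_filter, Fintype.mem_piFinset]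
    exact ⟨fun h i => ⟨h.1 i, h.2 i⟩, fun h => ⟨fun i => (h i).1, fun i => (h i).2⟩⟩
  rw [h1, Fintype.card_piFinset]
  push_cast
  refine prod_congr rfl fun i _ => ?_
  have := hn' i
  rw [card_piAntidiag_filter_le (b i) (by omega),
    Polynomial.preHilbertPoly_eq_choose_sub_add ℚ (s i) (hn' i), Nat.sub_sub]

open Finset Classical in
/-- The number of elements of an upper set with given block sums. -/
theorem eventuallyPolynomial_upperSet {r : ℕ} (s : Fin r → ℕ)
    (U : Set (∀ i, Fin (s i + 1) → ℕ)) (hU : IsUpperSet U) :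
    EventuallyPolynomial (∑ i, s i) (fun n : Fin r → ℕ =>
      ({a ∈ U | ∀ i, ∑ j, a i j = n i - s i}.ncard : ℚ)) := by
  classical
  -- Dickson's lemma: the product order is a well-quasi-order, so the antichain of minimal elements
  -- is finite and `U` is the union of the cones above them.
  have hfin : {a | Minimal (· ∈ U) a}.Finite :=
    WellQuasiOrderedLE.finite_of_isAntichain (setOfPred_minimal_antichain _)
  set B := hfin.toFinset
  let C (b : ∀ i, Fin (s i + 1) → ℕ) (n : Fin r → ℕ) : Finset (∀ i, Fin (s i + 1) → ℕ) :=
    {a ∈ Fintype.piFinset fun i =>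
        piAntidiag (univ : Finset (Fin (s i + 1))) (n i - s i) | b ≤ a}
  have hC : ∀ b n a, a ∈ C b n ↔ (∀ i, ∑ j, a i j = n i - s i) ∧ b ≤ a := by
    intro b n a
    simp [C]
  have h1 : ∀ n : Fin r → ℕ, {a ∈ U | ∀ i, ∑ j, a i j = n i - s i}.ncard =
      #(B.biUnion fun b => C b n) := by
    intro n
    rw [← Set.ncard_coe_finset]
    congr 1
    ext a
    simp only [Set.mem_ofPred_eq, coe_biUnion, Set.mem_iUnion, mem_coe, hC, exists_prop]
    constructor
    · rintro ⟨ha, hs⟩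
      obtain ⟨b, hb, hm⟩ := (Set.isPWO_of_wellQuasiOrderedLE U).exists_le_minimal ha
      exact ⟨b, hfin.mem_toFinset.2 hm, hs, hb⟩
    · rintro ⟨b, hb, hs, hba⟩
      exact ⟨hU hba (hfin.mem_toFinset.1 hb).1, hs⟩
  -- Cones are closed under intersection: an intersection of cones is the cone above the supremum of
  -- their vertices.
  have h2 : ∀ (t : Finset (∀ i, Fin (s i + 1) → ℕ)) (ht : t.Nonempty) (n : Fin r → ℕ),
      (t.inf' ht fun b => C b n) = C (t.sup' ht id) n := by
    intro t ht n
    ext a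
    rw [hC, sup'_le_iff]
    induction ht using Nonempty.cons_induction with
    | singleton b => simp [hC]
    | cons b t hb ht ih =>
      rw [inf'_cons ht, inf_eq_inter, mem_inter, ih, hC]
      simp only [mem_cons, forall_eq_or_imp, id]
      tauto
  -- Inclusion-exclusion over the non-empty sets of minimal elements. The index set does not depend
  -- on `n`.
  have h3 : ∀ n : Fin r → ℕ, ({a ∈ U | ∀ i, ∑ j, a i j = n i - s i}.ncard : ℚ) =
      ∑ t : B.powerset.filter (·.Nonempty),
        (-1 : ℚ) ^ (#t.1 + 1) * #(C (t.1.sup' (mem_filter.1 t.2).2 id) n) := by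
    intro n
    rw [h1]
    have := congrArg (Int.cast : ℤ → ℚ) (inclusion_exclusion_card_biUnion B fun b => C b n)
    push_cast [h2] at this
    exact this
  simp only [h3]
  exact EventuallyPolynomial.sum _ fun t _ => (eventuallyPolynomial_cone s _).const_mul _

/-! ### Finite sets of slots, insertion of a slot, and encoding by gaps -/

/-- Indices `(i, t)` of the edges in `r` ordered blocks of edges. -/
abbrev Slot (r : ℕ) := Fin r ×ₗ ℕ

namespace Slot

variable {r : ℕ}

/-- The shift of the slots of block `i` from position `p` on, which makes room for a new slot. -/
def insertAt (i : Fin r) (p : ℕ) (a : Slot r) : Slot r :=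
  toLex ((ofLex a).1,
    if (ofLex a).1 = i ∧ p ≤ (ofLex a).2 then (ofLex a).2 + 1 else (ofLex a).2)

theorem insertAt_toLex (i : Fin r) (p : ℕ) (i' : Fin r) (t : ℕ) :
    insertAt i p (toLex (i', t)) = toLex (i', if i' = i ∧ p ≤ t then t + 1 else t) :=
  rfl

/-- Insertion never changes the block and is strictly increasing inside each block. This is the
compatibility with the order on which the leading-term argument rests. -/
theorem insertAt_strictMono (i : Fin r) (p : ℕ) : StrictMono (insertAt i p) := by
  intro a b h
  obtain ⟨⟨i₁, t₁⟩, rfl⟩ := toLex.surjective a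
  obtain ⟨⟨i₂, t₂⟩, rfl⟩ := toLex.surjective b
  rw [insertAt_toLex, insertAt_toLex]
  rw [Prod.Lex.toLex_lt_toLex] at h ⊢
  grind

/-- The positions within block `i` of a finite set of slots. -/
noncomputable def block (S : Finset (Slot r)) (i : Fin r) : Finset ℕ :=
  S.preimage (fun t => toLex (i, t)) fun _ _ _ _ h => (Prod.mk.inj (toLex.injective h)).2

@[simp]
theorem mem_block {S : Finset (Slot r)} {i : Fin r} {t : ℕ} : t ∈ block S i ↔ toLex (i, t) ∈ S :=
  Finset.mem_preimage

theorem sum_card_block (S : Finset (Slot r)) : ∑ i, (block S i).card = S.card := by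
  classical
  rw [Finset.card_eq_sum_card_fiberwise (f := fun a : Slot r => (ofLex a).1) (t := Finset.univ)
    fun _ _ => by simp]
  refine Finset.sum_congr rfl fun i _ => ?_
  refine Finset.card_bij (fun t _ => toLex (i, t)) (fun t ht => ?_) (fun t _ t' _ h => ?_)
    fun a ha => ?_
  · simpa using mem_block.1 ht
  · exact (Prod.mk.inj (toLex.injective h)).2
  · obtain ⟨⟨i₁, t₁⟩, rfl⟩ := toLex.surjective a
    simp only [Finset.mem_filter, ofLex_toLex] at ha
    obtain ⟨ha, rfl⟩ := ha
    exact ⟨t₁, mem_block.2 ha, rfl⟩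

end Slot

/-- Extension by zero of a finite sequence. -/
def extendZero {s : ℕ} (a : Fin s → ℕ) (l : ℕ) : ℕ := if h : l < s then a ⟨l, h⟩ else 0

theorem sum_range_extendZero {s : ℕ} (a : Fin s → ℕ) :
    ∑ l ∈ Finset.range s, extendZero a l = ∑ j, a j := by
  rw [Finset.sum_range]
  exact Finset.sum_congr rfl fun j _ => by simp [extendZero]

theorem extendZero_add_single {s : ℕ} (a : Fin s → ℕ) (j : Fin s) (l : ℕ) :
    extendZero (a + Pi.single j 1) l = extendZero a l + if (j : ℕ) = l then 1 else 0 := by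
  unfold extendZero
  split_ifs with h h' h' <;> simp_all [Pi.single_apply, Fin.ext_iff]
  all_goals omega

/-- The position of the `n`-th element of the set of natural numbers with gaps `a`. -/
def gapPosition {s : ℕ} (a : Fin (s + 1) → ℕ) (n : ℕ) : ℕ :=
  n + ∑ l ∈ Finset.range (n + 1), extendZero a l

theorem gapPosition_strictMono {s : ℕ} (a : Fin (s + 1) → ℕ) : StrictMono (gapPosition a) :=
  strictMono_nat_of_lt_succ fun n => by
    unfold gapPosition
    rw [Finset.sum_range_succ _ (n + 1)]
    omega

/-- Index `s` lies past the last element and serves as a sentinel: its position is the length of the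
block. -/
theorem gapPosition_last {s : ℕ} (a : Fin (s + 1) → ℕ) : gapPosition a s = s + ∑ j, a j := by
  rw [gapPosition, sum_range_extendZero]

/-- Gap `j` lies just before element `j`, so enlarging it moves exactly the elements from `j` on. -/
theorem gapPosition_add_single {s : ℕ} (a : Fin (s + 1) → ℕ) (j : Fin (s + 1)) (n : ℕ) :
    gapPosition (a + Pi.single j 1) n = gapPosition a n + if (j : ℕ) ≤ n then 1 else 0 := by
  simp only [gapPosition, extendZero_add_single, Finset.sum_add_distrib, Finset.sum_ite_eq,
    Finset.mem_range, Nat.lt_succ_iff, add_assoc]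

/-- Gaps are recovered as differences of successive positions. The last gap needs the sentinel
position `n = s`. -/
theorem gapPosition_inj {s : ℕ} {a b : Fin (s + 1) → ℕ}
    (h : ∀ n ≤ s, gapPosition a n = gapPosition b n) : a = b := by
  funext j
  have hj : extendZero a j = extendZero b j := by
    obtain ⟨n, hn⟩ := j
    cases n with
    | zero => simpa [gapPosition] using h 0 (zero_le)
    | succ n =>
      have h1 := h n (by omega)
      have h2 := h (n + 1) (by omega)
      unfold gapPosition at h1 h2
      rw [Finset.sum_range_succ, Finset.sum_range_succ _ (n + 1)] at h2
      change extendZero a (n + 1) = extendZero b (n + 1)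
      omega
  simpa [extendZero, j.2] using hj

theorem exists_gapPosition_eq {s m : ℕ} (x : Fin s → ℕ) (hx : StrictMono x) (hm : ∀ j, x j < m) :
    ∃ a : Fin (s + 1) → ℕ, s + ∑ j, a j = m ∧ ∀ j : Fin s, gapPosition a j = x j := by
  -- `X` is the sequence `x` continued by the sentinel `m`, and `A` is the number of places strictly
  -- between consecutive terms. By `hX` the truncated subtraction in `A` loses nothing in the range
  -- used.
  let X : ℕ → ℕ := fun l => if h : l < s then x ⟨l, h⟩ else m
  let A : ℕ → ℕ := fun l => X l - if l = 0 then 0 else X (l - 1) + 1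
  have hX : ∀ l < s, X l + 1 ≤ X (l + 1) := by
    intro l hl
    by_cases h : l + 1 < s
    · simp only [X, hl, h, dif_pos]
      exact hx (Fin.mk_lt_mk.2 (Nat.lt_succ_self l))
    · simp only [X, hl, h, dif_pos, dif_neg, not_false_eq_true]
      exact hm _
  have hA : ∀ l ≤ s, extendZero (fun j : Fin (s + 1) => A j) l = A l := fun l hl => by
    simp [extendZero, Nat.lt_succ_iff.2 hl]
  have key : ∀ l ≤ s, gapPosition (fun j : Fin (s + 1) => A j) l = X l := by
    intro l
    induction l with
    | zero =>
      have := hA 0 (Nat.zero_le _)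
      simp only [gapPosition, zero_add, Finset.sum_range_one, this]
      intro
      simp [A]
    | succ l ih =>
      intro hl
      have h1 := ih (by omega)
      have h2 := hX l (by omega)
      unfold gapPosition at h1 ⊢
      rw [Finset.sum_range_succ, hA _ hl]
      have h3 : A (l + 1) = X (l + 1) - (X l + 1) := rfl
      omega
  refine ⟨fun j => A j, ?_, fun j => ?_⟩
  · rw [← gapPosition_last, key s le_rfl]
    simp [X]
  · rw [key j j.2.le]
    simp [X]

/-- Any `b ≥ a` is reached from `a` by finitely many unit steps; the induction is on the total
difference of the coordinates. -/
theorem isUpperSet_of_add_single {r : ℕ} {s : Fin r → ℕ} {U : Set (∀ i, Fin (s i) → ℕ)}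
    (h : ∀ a ∈ U, ∀ i j, a + Pi.single i (Pi.single j 1) ∈ U) : IsUpperSet U := by
  have key : ∀ (n : ℕ) (a b : ∀ i, Fin (s i) → ℕ), a ≤ b → ∑ i, ∑ j, (b i j - a i j) = n →
      a ∈ U → b ∈ U := by
    intro n
    induction n with
    | zero =>
      intro a b hab hn ha
      convert ha
      funext i j
      have h1 := (Finset.sum_eq_zero_iff.1 hn) i (Finset.mem_univ i)
      have h2 := (Finset.sum_eq_zero_iff.1 h1) j (Finset.mem_univ j)
      have h3 : a i j ≤ b i j := hab i j
      omega
    | succ n ih =>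
      intro a b hab hn ha
      obtain ⟨i, -, hi⟩ := Finset.exists_ne_zero_of_sum_ne_zero (hn.trans_ne n.succ_ne_zero)
      obtain ⟨j, -, hj⟩ := Finset.exists_ne_zero_of_sum_ne_zero hi
      have hval : ∀ i' j', (a + Pi.single i (Pi.single j 1) : ∀ i, Fin (s i) → ℕ) i' j' =
          a i' j' + if (⟨i', j'⟩ : Σ i, Fin (s i)) = ⟨i, j⟩ then 1 else 0 := by
        intro i' j'
        by_cases hii : i' = i
        · subst hii
          simp [Pi.single_apply]
        · simp [hii]
      have hle : a + Pi.single i (Pi.single j 1) ≤ b := by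
        intro i' j'
        change (_ : ℕ) ≤ b i' j'
        rw [hval]
        have h0 : a i' j' ≤ b i' j' := hab i' j'
        split_ifs with heq
        · cases heq
          omega
        · omega
      refine ih _ b hle ?_ (h a ha i j)
      have h1 : ∑ i', ∑ j', (b i' j' - a i' j') = ∑ i', ∑ j', ((b i' j' -
          (a + Pi.single i (Pi.single j 1) : ∀ i, Fin (s i) → ℕ) i' j') +
          if (⟨i', j'⟩ : Σ i, Fin (s i)) = ⟨i, j⟩ then 1 else 0) := by
        refine Finset.sum_congr rfl fun i' _ => Finset.sum_congr rfl fun j' _ => ?_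
        have h1 : _ ≤ b i' j' := hle i' j'
        rw [hval] at h1 ⊢
        omega
      have h2 : ∑ i', ∑ j', (if (⟨i', j'⟩ : Σ i, Fin (s i)) = ⟨i, j⟩ then 1 else 0) = 1 := by
        rw [← Fintype.sum_sigma (fun q : Σ i, Fin (s i) => if q = ⟨i, j⟩ then 1 else 0)]
        exact Fintype.sum_ite_eq' _ _
      simp only [Finset.sum_add_distrib, h2] at h1
      omega
  exact fun a b hab ha => key _ a b hab rfl ha

namespace Slot

variable {r : ℕ}

/-- The finite set of slots whose `i`-th block has gaps `a i`. -/
def ofGaps {s : Fin r → ℕ} (a : ∀ i, Fin (s i + 1) → ℕ) : Finset (Slot r) :=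
  Finset.univ.image fun q : Σ i, Fin (s i) => toLex (q.1, gapPosition (a q.1) q.2)

theorem mem_ofGaps {s : Fin r → ℕ} {a : ∀ i, Fin (s i + 1) → ℕ} {i : Fin r} {t : ℕ} :
    toLex (i, t) ∈ ofGaps a ↔ ∃ j : Fin (s i), gapPosition (a i) j = t := by
  simp only [ofGaps, Finset.mem_image, Finset.mem_univ, true_and, Sigma.exists,
    EmbeddingLike.apply_eq_iff_eq, Prod.mk.injEq]
  constructor
  · rintro ⟨i', j, rfl, h⟩
    exact ⟨j, h⟩
  · rintro ⟨j, h⟩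
    exact ⟨i, j, rfl, h⟩

theorem card_block_ofGaps {s : Fin r → ℕ} (a : ∀ i, Fin (s i + 1) → ℕ) (i : Fin r) :
    (block (ofGaps a) i).card = s i := by
  have : block (ofGaps a) i = Finset.univ.image fun j : Fin (s i) => gapPosition (a i) j := by
    ext t
    simp [mem_ofGaps]
  rw [this, Finset.card_image_of_injective, Finset.card_univ, Fintype.card_fin]
  exact fun j j' h => Fin.ext ((gapPosition_strictMono _).injective h)

/-- Listing the set in increasing order recovers every position except the sentinel. The set does
not see the last gap of a block, so the block sums must be supplied. -/
theorem ofGaps_inj {s : Fin r → ℕ} {a b : ∀ i, Fin (s i + 1) → ℕ} (h : ofGaps a = ofGaps b)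
    (hs : ∀ i, ∑ j, a i j = ∑ j, b i j) : a = b := by
  funext i
  have hmono : ∀ c : Fin (s i + 1) → ℕ, StrictMono fun j : Fin (s i) => gapPosition c j :=
    fun c j j' hj => gapPosition_strictMono c hj
  have hr : (fun j : Fin (s i) => gapPosition (a i) j) =
      fun j : Fin (s i) => gapPosition (b i) j := by
    rw [← (hmono _).range_inj (hmono _)]
    ext t
    rw [Set.mem_range, Set.mem_range, ← mem_ofGaps, ← mem_ofGaps, h]
  refine gapPosition_inj fun n hn => ?_
  rcases hn.lt_or_eq with hn | rfl
  · exact congrFun hr ⟨n, hn⟩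
  · rw [gapPosition_last, gapPosition_last, hs i]

theorem exists_ofGaps_eq (S : Finset (Slot r)) (m : Fin r → ℕ)
    (hS : ∀ i t, toLex (i, t) ∈ S → t < m i) {s : Fin r → ℕ} (hs : ∀ i, (block S i).card = s i) :
    ∃ a : ∀ i, Fin (s i + 1) → ℕ, (∀ i, s i + ∑ j, a i j = m i) ∧ ofGaps a = S := by
  have h1 : ∀ i, ∃ a : Fin (s i + 1) → ℕ, s i + ∑ j, a j = m i ∧
      ∀ j : Fin (s i), gapPosition a j = (block S i).orderEmbOfFin (hs i) j := by
    intro i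
    refine exists_gapPosition_eq _ ((block S i).orderEmbOfFin (hs i)).strictMono fun j => ?_
    exact hS i _ (mem_block.1 (Finset.orderEmbOfFin_mem _ _ _))
  choose a ha ha' using h1
  refine ⟨a, ha, ?_⟩
  ext x
  obtain ⟨⟨i, t⟩, rfl⟩ := toLex.surjective x
  rw [mem_ofGaps, ← mem_block, ← Finset.mem_coe, ← Finset.range_orderEmbOfFin _ (hs i)]
  simp only [ha', Set.mem_range]

/-- Enlarging gap `j` amounts to inserting an empty slot at the position of element `j`. For the
last gap the insertion happens at the end of the block and the set does not change. -/
theorem ofGaps_add_single {s : Fin r → ℕ} (a : ∀ i, Fin (s i + 1) → ℕ) (i : Fin r)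
    (j : Fin (s i + 1)) : ofGaps (a + Pi.single i (Pi.single j 1)) =
      (ofGaps a).image (insertAt i (gapPosition (a i) j)) := by
  unfold ofGaps
  rw [Finset.image_image]
  refine Finset.image_congr fun q _ => ?_
  obtain ⟨i', n⟩ := q
  simp only [Function.comp, insertAt_toLex]
  by_cases h : i' = i
  · subst h
    simp only [Pi.add_apply, Pi.single_eq_same, gapPosition_add_single, true_and,
      (gapPosition_strictMono (a i')).le_iff_le]
    split_ifs <;> rfl
  · simp [h]

/-- A family of finite sets of slots which is stable under insertion has a polynomial number of
members. -/
theorem eventuallyPolynomial_ncard {I : Type*} {d : ℕ} (size : I → Fin r → ℕ)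
    (hsize : Function.Injective size)
    (hsucc : ∀ x i, ∃ y, size y = size x + Pi.single i 1)
    (F : I → Set (Finset (Slot r)))
    (hb : ∀ x, ∀ S ∈ F x, ∀ i t, toLex (i, t) ∈ S → t < size x i)
    (hd : ∀ x, ∀ S ∈ F x, S.card ≤ d)
    (hF : ∀ x y i p, size y = size x + Pi.single i 1 → p ≤ size x i → ∀ S ∈ F x,
      S.image (insertAt i p) ∈ F y) :
    ∃ P : (Fin r → ℕ) → ℚ, EventuallyPolynomial d P ∧
      ∀ x, (∀ i, d ≤ size x i) → ((F x).ncard : ℚ) = P (size x) := by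
  classical
  -- The gap vectors of all members having `s i` slots in block `i`, with all sizes taken together.
  -- The vector determines the sizes, and by `hsize` these determine the index `x`.
  let U (s : Fin r → ℕ) : Set (∀ i, Fin (s i + 1) → ℕ) :=
    {a | ∃ x, (∀ i, s i + ∑ j, a i j = size x i) ∧ ofGaps a ∈ F x}
  have hU : ∀ s, IsUpperSet (U s) := by
    intro s
    refine isUpperSet_of_add_single fun a ha i j => ?_
    obtain ⟨x, hx, hax⟩ := ha
    obtain ⟨y, hy⟩ := hsucc x i
    refine ⟨y, fun i' => ?_, ?_⟩
    · rw [hy, Pi.add_apply, Pi.add_apply, ← hx i']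
      by_cases h : i' = i
      · subst h
        simp only [Pi.add_apply, Pi.single_eq_same, Finset.sum_add_distrib, Fintype.sum_pi_single',
          add_assoc]
      · simp [h]
    · rw [ofGaps_add_single]
      refine hF x y i _ hy ?_ _ hax
      rw [← hx i, ← gapPosition_last]
      exact (gapPosition_strictMono _).monotone (Nat.lt_succ_iff.1 j.2)
  -- All possible distributions of at most `d` slots over the blocks.
  let T : Finset (Fin r → ℕ) :=
    (Fintype.piFinset fun _ => Finset.range (d + 1)).filter fun s => ∑ i, s i ≤ d
  refine ⟨fun n => ∑ s ∈ T, ({a ∈ U s | ∀ i, ∑ j, a i j = n i - s i}.ncard : ℚ), ?_, ?_⟩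
  · refine EventuallyPolynomial.sum T fun s hs => ?_
    exact (eventuallyPolynomial_upperSet s (U s) (hU s)).mono (Finset.mem_filter.1 hs).2
  · intro x hx
    -- This is where sizes of at least `d` are needed: the truncated difference `size x i - s i` is
    -- then a true one.
    have hsd : ∀ s ∈ T, ∀ i, s i ≤ size x i := fun s hs i => by
      have := Finset.mem_range.1 (Fintype.mem_piFinset.1 (Finset.mem_filter.1 hs).1 i)
      have := hx i
      omega
    -- `ofGaps` is a bijection from the gap vectors with the block sums of `x` onto the members of
    -- `F x` with `s i` slots in block `i`.
    have hcard : ∀ s ∈ T, {a ∈ U s | ∀ i, ∑ j, a i j = size x i - s i}.ncard =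
        {S ∈ F x | (fun i => (block S i).card) = s}.ncard := by
      intro s hs
      rw [← Set.InjOn.ncard_image (f := ofGaps)]
      · congr 1
        ext S
        simp only [Set.mem_image, Set.mem_ofPred_eq]
        constructor
        · rintro ⟨a, ⟨⟨y, hy, hay⟩, ha⟩, rfl⟩
          have hxy : y = x := hsize (funext fun i => by
            rw [← hy i, ha i]
            have := hsd s hs i
            omega)
          exact ⟨hxy ▸ hay, funext fun i => card_block_ofGaps a i⟩
        · rintro ⟨hS, hSs⟩
          obtain ⟨a, ha, haS⟩ := exists_ofGaps_eq S (size x) (hb x S hS) fun i => congrFun hSs i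
          refine ⟨a, ⟨⟨x, ha, haS.symm ▸ hS⟩, fun i => ?_⟩, haS⟩
          have := ha i
          omega
      · intro a ha b hb h
        exact ofGaps_inj h fun i => (ha.2 i).trans (hb.2 i).symm
    have hfin : (F x).Finite := by
      refine Set.Finite.subset (Finset.finite_toSet (Finset.univ.biUnion fun i : Fin r =>
        (Finset.range (size x i)).image fun t => (toLex (i, t) : Slot r)).powerset) fun S hS => ?_
      rw [Finset.mem_coe, Finset.mem_powerset]
      intro a ha
      obtain ⟨⟨i, t⟩, rfl⟩ := toLex.surjective a
      simp only [Finset.mem_biUnion, Finset.mem_image, Finset.mem_univ, true_and]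
      exact ⟨i, t, Finset.mem_range.2 (hb x S hS i t ha), rfl⟩
    have hmap : ∀ S ∈ hfin.toFinset, (fun i => (block S i).card) ∈ T := by
      intro S hS
      have h1 := hd x S (hfin.mem_toFinset.1 hS)
      rw [← sum_card_block] at h1
      refine Finset.mem_filter.2 ⟨Fintype.mem_piFinset.2 fun i => Finset.mem_range.2 ?_, h1⟩
      exact Nat.lt_succ_iff.2 ((Finset.single_le_sum (f := fun i => (block S i).card)
        (fun _ _ => Nat.zero_le _) (Finset.mem_univ i)).trans h1)
    rw [Set.ncard_eq_toFinset_card _ hfin, Finset.card_eq_sum_card_fiberwise hmap]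
    push_cast
    refine Finset.sum_congr rfl fun s hs => ?_
    rw [hcard s hs, ← Set.ncard_coe_finset]
    congr 3
    ext S
    simp

end Slot

/-! ### Leading exponents of subspaces of a free vector space -/

section LeadingExponents

variable {k Ω : Type*} [Field k] [LinearOrder Ω]

/-- The leading exponents of the elements of `V`. -/
def leadingExponents (V : Submodule k (Ω →₀ k)) : Set Ω :=
  {b | ∃ f ∈ V, f b ≠ 0 ∧ ∀ c, b < c → f c = 0}

theorem exists_mem_leadingExponents {V : Submodule k (Ω →₀ k)} {f : Ω →₀ k} (hf : f ∈ V)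
    (h : f ≠ 0) : ∃ b ∈ leadingExponents V, f b ≠ 0 ∧ ∀ c, b < c → f c = 0 := by
  have hs : f.support.Nonempty := Finsupp.support_nonempty_iff.2 h
  have h1 : f (f.support.max' hs) ≠ 0 := Finsupp.mem_support_iff.1 (f.support.max'_mem hs)
  have h2 : ∀ c, f.support.max' hs < c → f c = 0 := fun c hc => by
    by_contra hne
    exact hc.not_ge (f.support.le_max' c (Finsupp.mem_support_iff.2 hne))
  exact ⟨_, ⟨f, hf, h1, h2⟩, h1, h2⟩

/-- The dimension of a space of finitely supported functions is the number of its leading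
exponents. -/
theorem finrank_eq_ncard_leadingExponents (V : Submodule k (Ω →₀ k)) [FiniteDimensional k V] :
    Module.finrank k V = (leadingExponents V).ncard := by
  classical
  choose f hfV hf hf' using fun b : leadingExponents V => b.2
  let v : leadingExponents V → V := fun b => ⟨f b, hfV b⟩
  have hlf : LinearIndependent k f := by
    rw [linearIndependent_iff']
    intro s c hc
    by_contra! hne
    have hs : (s.filter fun b => c b ≠ 0).Nonempty := by
      obtain ⟨b, hb, hcb⟩ := hne
      exact ⟨b, Finset.mem_filter.2 ⟨hb, hcb⟩⟩
    set b := (s.filter fun b => c b ≠ 0).max' hs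
    obtain ⟨hbs, hcb⟩ := Finset.mem_filter.1 ((s.filter fun b => c b ≠ 0).max'_mem hs)
    -- The relation is read at the greatest exponent `b` with non-zero coefficient. Elements with
    -- smaller leading exponent vanish there, and those with larger one have coefficient zero.
    have h1 := congrArg (fun x : Ω →₀ k => x b) hc
    simp only [Finsupp.finsetSum_apply, Finsupp.smul_apply, smul_eq_mul,
      Finsupp.zero_apply] at h1
    rw [Finset.sum_eq_single_of_mem b hbs] at h1
    · exact (mul_ne_zero hcb (hf b)) h1
    · intro b' hb' hne'
      rcases lt_or_gt_of_ne hne' with hlt | hlt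
      · rw [hf' b' b hlt, mul_zero]
      · have : c b' = 0 := by
          by_contra hcb'
          exact hlt.not_ge (Finset.le_max' _ _ (Finset.mem_filter.2 ⟨hb', hcb'⟩))
        rw [this, zero_mul]
  have hli : LinearIndependent k v := LinearIndependent.of_comp V.subtype hlf
  have hfin : Finite (leadingExponents V) := hli.finite
  -- Reduction as in Gaussian elimination: subtracting a multiple of `v b` cancels the coefficient
  -- at `b`, so the remainder is zero or has a smaller leading exponent. The induction is
  -- well-founded because there are finitely many leading exponents.
  have hspan : ∀ (b : leadingExponents V) (x : V), (∀ c, b.1 < c → (x : Ω →₀ k) c = 0) →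
      x ∈ Submodule.span k (Set.range v) := by
    intro b
    induction b using WellFoundedLT.induction with
    | ind b ih =>
    intro x hx
    have hvb := Submodule.subset_span (R := k) (Set.mem_range_self (f := v) b)
    set y := x - ((x : Ω →₀ k) b / f b b) • v b with hy
    have hyc : ∀ c, (y : Ω →₀ k) c = (x : Ω →₀ k) c - (x : Ω →₀ k) b / f b b * f b c :=
      fun c => by simp [hy, v]
    have hx' : x = y + ((x : Ω →₀ k) b / f b b) • v b :=
      (sub_add_cancel x _).symm
    rw [hx']
    refine add_mem ?_ (Submodule.smul_mem _ _ hvb)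
    by_cases hy0 : y = 0
    · rw [hy0]
      exact zero_mem _
    obtain ⟨b', hb', h1, h2⟩ := exists_mem_leadingExponents y.2 (fun h => hy0 (Subtype.ext h))
    refine ih ⟨b', hb'⟩ ?_ y h2
    by_contra hlt
    refine h1 ?_
    rcases (not_lt.1 hlt).lt_or_eq with hlt | heq
    · rw [hyc, hx _ hlt, hf' b _ hlt, mul_zero, sub_zero]
    · have : (b : Ω) = b' := congrArg Subtype.val heq
      rw [hyc, ← this, div_mul_cancel₀ _ (hf b), sub_self]
  have htop : ⊤ ≤ Submodule.span k (Set.range v) := by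
    intro x _
    by_cases hx : x = 0
    · rw [hx]
      exact zero_mem _
    obtain ⟨b, hb, -, h⟩ := exists_mem_leadingExponents x.2 (fun h => hx (Subtype.ext h))
    exact hspan ⟨b, hb⟩ x h
  rw [Module.finrank_eq_nat_card_basis (Module.Basis.mk hli htop), Nat.card_coe_set_eq]

/-- A strictly increasing relabelling of the basis keeps the greatest exponent greatest, and
exponents outside its range have coefficient zero. -/
theorem mem_leadingExponents_of_strictMono {V W : Submodule k (Ω →₀ k)} {e : Ω → Ω}
    (he : StrictMono e) (h : ∀ f ∈ V, f.mapDomain e ∈ W) {b : Ω} (hb : b ∈ leadingExponents V) :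
    e b ∈ leadingExponents W := by
  obtain ⟨f, hf, h1, h2⟩ := hb
  refine ⟨_, h f hf, by rwa [Finsupp.mapDomain_apply he.injective], fun c hc => ?_⟩
  by_cases hce : c ∈ Set.range e
  · obtain ⟨c, rfl⟩ := hce
    rw [Finsupp.mapDomain_apply he.injective]
    exact h2 c (he.lt_iff_lt.1 hc)
  · exact Finsupp.mapDomain_of_notMem_range _ _ hce

end LeadingExponents

/-! ### Dimensions of subspaces stable under insertion -/

namespace Slot

variable {r : ℕ}

/-- Labelled finite sets of slots. -/
abbrev Labelled (n r : ℕ) := Fin n ×ₗ Colex (Finset (Slot r))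

/-- Insertion of a slot into a labelled finite set of slots. -/
def Labelled.insertAt {n : ℕ} (i : Fin r) (p : ℕ) (w : Labelled n r) : Labelled n r :=
  toLex ((ofLex w).1, toColex ((ofColex (ofLex w).2).image (Slot.insertAt i p)))

/-- The label is kept, and a strictly increasing map of slots preserves the colexicographic order of
their finite sets. -/
theorem Labelled.insertAt_strictMono {n : ℕ} (i : Fin r) (p : ℕ) :
    StrictMono (Labelled.insertAt (n := n) i p) := by
  intro a b h
  obtain ⟨⟨t₁, S₁⟩, rfl⟩ := toLex.surjective a
  obtain ⟨⟨t₂, S₂⟩, rfl⟩ := toLex.surjective b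
  unfold Labelled.insertAt
  rw [Prod.Lex.toLex_lt_toLex] at h ⊢
  rcases h with h | ⟨h, h'⟩
  · exact Or.inl h
  · exact Or.inr ⟨h, Finset.Colex.toColex_image_ofColex_strictMono
      (Slot.insertAt_strictMono i p) h'⟩

/-- Let `B x` be finite sets whose elements are determined by a label and a finite set of at most
`d` slots. Subspaces of the spaces with bases `B x` which are stable under insertion of slots have
eventually polynomial dimension. -/
theorem eventuallyPolynomial_finrank {k : Type*} [Field k] {I T : Type*} [Finite T] {d : ℕ}
    (size : I → Fin r → ℕ) (hsize : Function.Injective size)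
    (hsucc : ∀ x i, ∃ y, size y = size x + Pi.single i 1)
    (B : I → Type*) [∀ x, Finite (B x)] (label : ∀ x, B x → T)
    (supp : ∀ x, B x → Finset (Slot r))
    (hinj : ∀ x (b b' : B x), label x b = label x b' → supp x b = supp x b' → b = b')
    (hb : ∀ x b i t, toLex (i, t) ∈ supp x b → t < size x i)
    (hd : ∀ x b, (supp x b).card ≤ d)
    (V : ∀ x, Submodule k (B x →₀ k))
    (hV : ∀ x y i p, size y = size x + Pi.single i 1 → p ≤ size x i → ∃ π : B x → B y,
      (∀ b, label y (π b) = label x b) ∧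
      (∀ b, supp y (π b) = (supp x b).image (insertAt i p)) ∧
      ∀ f ∈ V x, f.mapDomain π ∈ V y) :
    ∃ P : (Fin r → ℕ) → ℚ, EventuallyPolynomial d P ∧
      ∀ x, (∀ i, d ≤ size x i) → (Module.finrank k (V x) : ℚ) = P (size x) := by
  classical
  obtain ⟨n, ⟨enum⟩⟩ := Finite.exists_equiv_fin T
  -- All bases `B x` are embedded in one linearly ordered set, so that subspaces for different `x`
  -- can be compared through their leading exponents.
  let code : ∀ x, B x → Labelled n r := fun x b => toLex (enum (label x b), toColex (supp x b))
  have hcode : ∀ x, Function.Injective (code x) := by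
    intro x b b' h
    have h := Prod.mk.inj (toLex.injective h)
    exact hinj x b b' (enum.injective h.1) (toColex.injective h.2)
  let W : ∀ x, Submodule k (Labelled n r →₀ k) := fun x =>
    (V x).map (Finsupp.lmapDomain k k (code x))
  have hWrange : ∀ x, ∀ w ∈ leadingExponents (W x), w ∈ Set.range (code x) := by
    rintro x w ⟨_, ⟨f, -, rfl⟩, h, -⟩
    by_contra hw
    exact h (Finsupp.mapDomain_of_notMem_range _ _ hw)
  have hW : ∀ x y i p, size y = size x + Pi.single i 1 → p ≤ size x i →
      ∀ w ∈ leadingExponents (W x), Labelled.insertAt i p w ∈ leadingExponents (W y) := by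
    intro x y i p hxy hp w hw
    refine mem_leadingExponents_of_strictMono (Labelled.insertAt_strictMono i p) ?_ hw
    rintro _ ⟨f, hf, rfl⟩
    obtain ⟨π, h1, h2, h3⟩ := hV x y i p hxy hp
    refine ⟨f.mapDomain π, h3 f hf, ?_⟩
    simp only [Finsupp.lmapDomain_apply, ← Finsupp.mapDomain_comp]
    congr 1
    funext b
    simp only [Function.comp, code, Labelled.insertAt, h1, h2]
    rfl
  have hfr : ∀ x, Module.finrank k (V x) = (leadingExponents (W x)).ncard := by
    intro x
    rw [← finrank_eq_ncard_leadingExponents]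
    exact (Submodule.equivMapOfInjective (Finsupp.lmapDomain k k (code x))
      (Finsupp.mapDomain_injective (hcode x)) (V x)).finrank_eq
  -- Insertion fixes labels, so the leading exponents split by label into finitely many families of
  -- sets of slots, each stable under insertion.
  let F : Fin n → I → Set (Finset (Slot r)) := fun t x =>
    {S | (toLex (t, toColex S) : Labelled n r) ∈ leadingExponents (W x)}
  have hF : ∀ t, ∃ P : (Fin r → ℕ) → ℚ, EventuallyPolynomial d P ∧
      ∀ x, (∀ i, d ≤ size x i) → ((F t x).ncard : ℚ) = P (size x) := by
    intro t
    have hmem : ∀ x, ∀ S ∈ F t x, ∃ b, supp x b = S := by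
      intro x S hS
      obtain ⟨b, hb⟩ := hWrange x _ hS
      exact ⟨b, toColex.injective (Prod.mk.inj (toLex.injective hb)).2⟩
    refine eventuallyPolynomial_ncard size hsize hsucc (F t) ?_ ?_ ?_
    · intro x S hS
      obtain ⟨b, rfl⟩ := hmem x S hS
      exact hb x b
    · intro x S hS
      obtain ⟨b, rfl⟩ := hmem x S hS
      exact hd x b
    · intro x y i p hxy hp S hS
      exact hW x y i p hxy hp _ hS
  choose P hP hP' using hF
  refine ⟨fun n => ∑ t, P t n, EventuallyPolynomial.sum _ fun t _ => hP t, fun x hx => ?_⟩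
  have hfin : (leadingExponents (W x)).Finite :=
    (Set.finite_range (code x)).subset fun w hw => hWrange x w hw
  rw [hfr, Set.ncard_eq_toFinset_card _ hfin, Finset.card_eq_sum_card_fiberwise
    (f := fun w : Labelled n r => (ofLex w).1) (t := Finset.univ) fun _ _ => by simp]
  push_cast
  refine Finset.sum_congr rfl fun t _ => ?_
  rw [← hP' t x hx, ← Set.ncard_coe_finset]
  congr 1
  symm
  refine Set.ncard_congr (fun S _ => toLex (t, toColex S)) (fun S hS => ?_) (fun S S' _ _ h => ?_)
    fun w hw => ?_
  · simpa [F] using hS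
  · exact toColex.injective (Prod.mk.inj (toLex.injective h)).2
  · obtain ⟨⟨t', S⟩, rfl⟩ := toLex.surjective w
    simp only [Finset.coe_filter, Set.Finite.mem_toFinset, ofLex_toLex, Set.mem_ofPred_eq] at hw
    obtain ⟨hw, rfl⟩ := hw
    exact ⟨ofColex S, hw, rfl⟩

end Slot

/-! ### Linear algebra of filtrations and preimages -/

open DirectSum in
/-- A vector space with an exhaustive and separated filtration by the images of the maps `j i` has
the dimension of its associated graded space, if that is finite. -/
theorem finite_and_finrank_eq_of_filtration {k : Type*} [Field k] {V : Type*} [AddCommGroup V]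
    [Module k V] {E G : ℤ → Type*} [∀ i, AddCommGroup (E i)] [∀ i, Module k (E i)]
    [∀ i, AddCommGroup (G i)] [∀ i, Module k (G i)] (j : ∀ i, E i →ₗ[k] V)
    (hj : ∀ i, Function.Injective (j i)) (t : ∀ i, E (i - 1) →ₗ[k] E i)
    (hjt : ∀ i x, j i (t i x) = j (i - 1) x) (e : ∀ i, G i ≃ₗ[k] (E i ⧸ LinearMap.range (t i)))
    (hex : ∀ x, ∃ i y, j i y = x) (hsep : ∀ x, (∀ i, ∃ y, j i y = x) → x = 0)
    [Module.Finite k (⨁ i, G i)] :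
    Module.Finite k V ∧ Module.finrank k V = Module.finrank k (⨁ i, G i) := by
  classical
  let β := fun i => Module.Basis.ofVectorSpace k (G i)
  let η := fun i => Module.Basis.ofVectorSpaceIndex k (G i)
  have hD : Module.Finite k (Π₀ i, G i) := ‹Module.Finite k (⨁ i, G i)›
  have hfin : Finite (Σ i, η i) := Module.Finite.finite_basis (DFinsupp.basis β)
  have hη : ∀ i, Finite (η i) := fun i => Finite.of_injective (Sigma.mk (β := fun i => η i) i)
    sigma_mk_injective
  have hG : ∀ i, Module.Finite k (G i) := fun i => Module.Finite.of_basis (β i)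
  -- Only finitely many graded pieces are non-zero. All their indices lie between `a` and `b`, and
  -- outside this range the filtration is constant.
  have hs : (Set.range (Sigma.fst : (Σ i, η i) → ℤ)).Finite := Set.finite_range _
  obtain ⟨a, ha⟩ := hs.bddBelow
  obtain ⟨b, hb⟩ := hs.bddAbove
  have hmem : ∀ i, Nonempty (η i) → a ≤ i ∧ i ≤ b := fun i ⟨x⟩ =>
    ⟨ha ⟨⟨i, x⟩, rfl⟩, hb ⟨⟨i, x⟩, rfl⟩⟩
  have hrange : ∀ i, ¬(a ≤ i ∧ i ≤ b) → LinearMap.range (t i) = ⊤ := by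
    intro i hi
    have : IsEmpty (η i) := not_nonempty_iff.1 fun h => hi (hmem i h)
    have : Subsingleton (G i) := (β i).repr.toEquiv.subsingleton
    have : Subsingleton (E i ⧸ LinearMap.range (t i)) := (e i).symm.toEquiv.subsingleton
    exact Submodule.Quotient.subsingleton_iff.1 this
  let R : ℤ → Submodule k V := fun i => LinearMap.range (j i)
  have hcomp : ∀ i, R (i - 1) = (LinearMap.range (t i)).map (j i) := by
    intro i
    rw [← LinearMap.range_comp]
    exact congrArg LinearMap.range (LinearMap.ext fun x => (hjt i x).symm)
  have hRle : ∀ i, R (i - 1) ≤ R i := by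
    intro i
    rw [hcomp]
    exact LinearMap.map_le_range
  have hReq : ∀ i, ¬(a ≤ i ∧ i ≤ b) → R (i - 1) = R i := by
    intro i hi
    rw [hcomp, hrange i hi, Submodule.map_top]
  have hRmono : Monotone R := monotone_int_of_le_succ fun i => by simpa using hRle (i + 1)
  have hdown : ∀ i ≤ a - 1, R (a - 1) ≤ R i := by
    intro i hi
    induction i, hi using Int.leInductionDown with
    | base => exact le_rfl
    | pred i hi ih => exact ih.trans_eq (hReq i (by omega)).symm
  have hup : ∀ i, b ≤ i → R i ≤ R b := by
    intro i hi
    induction i, hi using Int.leInduction with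
    | base => exact le_rfl
    | succ i hi ih =>
      have := hReq (i + 1) (by omega)
      rw [add_sub_cancel_right] at this
      exact this.symm.trans_le ih
  -- The constant value below `a` lies in every step of the filtration, so it vanishes by
  -- separatedness.
  have hbot : R (a - 1) = ⊥ := by
    rw [eq_bot_iff]
    intro x hx
    refine (Submodule.mem_bot k).2 (hsep x fun i => ?_)
    rcases le_total i (a - 1) with hi | hi
    · exact hdown i hi hx
    · exact hRmono hi hx
  have hfr : ∀ i, a - 1 ≤ i → Module.Finite k (R i) ∧
      Module.finrank k (R i) = ∑ l ∈ Finset.Ioc (a - 1) i, Nat.card (η l) := by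
    intro i hi
    induction i, hi using Int.leInduction with
    | base =>
      rw [hbot]
      exact ⟨inferInstance, by simp⟩
    | succ i hi ih =>
      obtain ⟨h1, h2⟩ := ih
      have hi' : i + 1 - 1 = i := add_sub_cancel_right _ _
      have e1 : LinearMap.range (t (i + 1)) ≃ₗ[k] R (i + 1 - 1) :=
        (Submodule.equivMapOfInjective (j (i + 1)) (hj (i + 1)) _).trans
          (LinearEquiv.ofEq _ _ (hcomp (i + 1)).symm)
      rw [← hi'] at h1 h2
      have h3 : Module.Finite k (LinearMap.range (t (i + 1))) := Module.Finite.equiv e1.symm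
      have h4 : Module.Finite k (E (i + 1) ⧸ LinearMap.range (t (i + 1))) :=
        Module.Finite.equiv (e (i + 1))
      have h5 : Module.Finite k (E (i + 1)) :=
        Module.Finite.of_submodule_quotient (LinearMap.range (t (i + 1)))
      have e2 : E (i + 1) ≃ₗ[k] R (i + 1) := LinearEquiv.ofInjective (j (i + 1)) (hj (i + 1))
      refine ⟨Module.Finite.equiv e2, ?_⟩
      rw [← e2.finrank_eq, ← Submodule.finrank_quotient_add_finrank (LinearMap.range (t (i + 1))),
        e1.finrank_eq, h2, ← (e (i + 1)).finrank_eq, Module.finrank_eq_nat_card_basis (β (i + 1)),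
        hi', ← Finset.insert_Ioc_right_eq_Ioc_add_one hi, Finset.sum_insert (by simp)]
  -- The maximum covers the case in which all graded pieces vanish: then `a` and `b` are arbitrary
  -- and `b` may lie below `a - 1`.
  have htop : R (max b (a - 1)) = ⊤ := by
    rw [eq_top_iff]
    intro x _
    obtain ⟨i, hi⟩ := hex x
    have hx : x ∈ R i := hi
    rcases le_total b i with hbi | hbi
    · exact hRmono (le_max_left _ _) (hup i hbi hx)
    · exact hRmono (hbi.trans (le_max_left _ _)) hx
  obtain ⟨h1, h2⟩ := hfr (max b (a - 1)) (le_max_right _ _)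
  rw [htop] at h1 h2
  refine ⟨Module.Finite.equiv Submodule.topEquiv, ?_⟩
  rw [← finrank_top k V, h2]
  have h3 : Module.finrank k (⨁ i, G i) = Nat.card (Σ i, η i) :=
    Module.finrank_eq_nat_card_basis (DFinsupp.basis β)
  let J := Finset.Ioc (a - 1) (max b (a - 1))
  have h4 : Nat.card (Σ i : J, η i) = Nat.card (Σ i, η i) := by
    refine Nat.card_eq_of_bijective (fun x => ⟨x.1, x.2⟩) ⟨?_, ?_⟩
    · rintro ⟨⟨i, hi⟩, x⟩ ⟨⟨i', hi'⟩, x'⟩ h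
      cases h
      rfl
    · rintro ⟨i, x⟩
      have := hmem i ⟨x⟩
      exact ⟨⟨⟨i, Finset.mem_Ioc.2 ⟨by omega, this.2.trans (le_max_left _ _)⟩⟩, x⟩, rfl⟩
  rw [h3, ← h4, Nat.card_sigma]
  exact (Finset.sum_coe_sort J fun i => Nat.card (η i)).symm

/-- The dimension of the preimage of a subspace under a surjective map. -/
theorem finrank_comap_eq_add_ker {k : Type*} [Field k] {V W : Type*} [AddCommGroup V] [Module k V]
    [AddCommGroup W] [Module k W] [FiniteDimensional k V] (q : V →ₗ[k] W)
    (hq : Function.Surjective q) (U : Submodule k W) :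
    Module.finrank k (U.comap q) = Module.finrank k U + Module.finrank k (LinearMap.ker q) := by
  have h := LinearMap.finrank_range_add_finrank_ker (q.domRestrict (U.comap q))
  have h1 : LinearMap.range (q.domRestrict (U.comap q)) = U := by
    rw [LinearMap.range_domRestrict, Submodule.map_comap_eq_of_surjective hq]
  have h2 : LinearMap.ker (q.domRestrict (U.comap q)) =
      (LinearMap.ker q).comap (U.comap q).subtype := LinearMap.ker_domRestrict _ _
  rw [h1, h2, (Submodule.comapSubtypeEquivOfLe (LinearMap.ker_le_comap q)).finrank_eq] at h
  exact h.symm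

/-! ### From smallish modules to stable subspaces of free modules -/

namespace GraphModule

variable {k : Type u} [Field k] {g d : ℕ}

/-- Evaluation at a graph preserves coproducts, cokernels and monomorphisms, so the statement
reduces to a filtered vector space. -/
theorem finite_and_finrank_eq_gr {M : GraphModule k g} (F : Filtration M) (X : (GenusGraph g)ᵒᵖ)
    [hfin : Module.Finite k (F.gr.obj X)] :
    Module.Finite k (M.obj X) ∧ Module.finrank k (M.obj X) = Module.finrank k (F.gr.obj X) := by
  classical
  let ev : GraphModule k g ⥤ ModuleCat.{u} k := (evaluation _ _).obj X
  let τ : ∀ i : ℤ, Subobject.underlying.obj (F.F (i - 1)) ⟶ Subobject.underlying.obj (F.F i) :=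
    fun i => Subobject.ofLE (F.F (i - 1)) (F.F i) (F.mono (by omega))
  let Q : ℤ → ModuleCat.{u} k := fun i => ev.obj (cokernel (τ i))
  let e : F.gr.obj X ≅ ModuleCat.of k (DirectSum ℤ fun i => Q i) :=
    PreservesCoproduct.iso ev (fun i => cokernel (τ i)) ≪≫ ModuleCat.coprodIsoDirectSum Q
  have h1 : Module.Finite k (DirectSum ℤ fun i => Q i) :=
    Module.Finite.equiv e.toLinearEquiv
  rw [e.toLinearEquiv.finrank_eq]
  refine finite_and_finrank_eq_of_filtration (G := fun i => Q i)
    (E := fun i => (Subobject.underlying.obj (F.F i)).obj X)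
    (fun i => ((F.F i).arrow.app X).hom) ?_ (fun i => ((τ i).app X).hom) ?_ (fun i => ?_)
    (F.exhaustive X) (F.separated X)
  · intro i
    exact (ModuleCat.mono_iff_injective _).1 inferInstance
  · intro i x
    have h := congrArg (fun f : _ ⟶ M => (NatTrans.app f X).hom x)
      (Subobject.ofLE_arrow (X := F.F (i - 1)) (Y := F.F i) (F.mono (by omega)))
    exact h
  · exact (PreservesCokernel.iso ev (τ i) ≪≫
      ModuleCat.cokernelIsoRangeQuotient _).toLinearEquiv

/-- The concrete direct sum of principal projectives. -/
noncomputable def principalSum (k : Type u) [Field k] {n : ℕ} (Y : Fin n → GenusGraph g) :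
    GraphModule k g where
  obj H := ModuleCat.of k ((Σ i, (H.unop ⟶ Y i)) →₀ k)
  map f := ModuleCat.ofHom (Finsupp.lmapDomain k k fun φ => ⟨φ.1, f.unop ≫ φ.2⟩)
  map_id H := by
    ext φ
    simp
  map_comp f h := by
    ext φ
    simp

/-- The images under `p` of the basis elements define a natural map `q` on the concrete sum. Since
`p` factors as a map followed by `q`, the latter is an epimorphism as well. -/
theorem exists_principalSum_epi {N : GraphModule k g} {n : ℕ} {Y : Fin n → GenusGraph g}
    (p : (∐ fun i => principal k (Y i)) ⟶ N) [Epi p] :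
    ∃ q : principalSum k Y ⟶ N, Epi q := by
  let ι : ∀ i, principal k (Y i) ⟶ principalSum k Y := fun i =>
    { app := fun H => ModuleCat.ofHom (Finsupp.lmapDomain k k fun φ => ⟨i, φ⟩)
      naturality := fun H H' f => by
        refine ModuleCat.hom_ext (Finsupp.lhom_ext fun φ a => ?_)
        change Finsupp.mapDomain _ (Finsupp.mapDomain _ (Finsupp.single φ a)) =
          Finsupp.mapDomain _ (Finsupp.mapDomain _ (Finsupp.single φ a))
        simp only [Finsupp.mapDomain_single] }
  let c : ∀ (i : Fin n) (H : (GenusGraph g)ᵒᵖ), (H.unop ⟶ Y i) → N.obj H := fun i H φ =>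
    ((Sigma.ι (fun i => principal k (Y i)) i ≫ p).app H).hom (Finsupp.single φ 1)
  have hc : ∀ i {H H' : (GenusGraph g)ᵒᵖ} (f : H ⟶ H') φ,
      (N.map f).hom (c i H φ) = c i H' (f.unop ≫ φ) := by
    intro i H H' f φ
    have h := congrArg (fun α => α.hom (Finsupp.single φ 1))
      ((Sigma.ι (fun i => principal k (Y i)) i ≫ p).naturality f)
    refine h.symm.trans ?_
    exact congrArg ((Sigma.ι (fun i => principal k (Y i)) i ≫ p).app H').hom
      Finsupp.mapDomain_single
  let q : principalSum k Y ⟶ N :=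
    { app := fun H => ModuleCat.ofHom (Finsupp.linearCombination k fun x => c x.1 H x.2)
      naturality := fun H H' f => by
        refine ModuleCat.hom_ext (Finsupp.lhom_ext fun φ a => ?_)
        change Finsupp.linearCombination k _ (Finsupp.mapDomain _ (Finsupp.single φ a)) =
          (N.map f).hom (Finsupp.linearCombination k _ (Finsupp.single φ a))
        rw [Finsupp.mapDomain_single, Finsupp.linearCombination_single,
          Finsupp.linearCombination_single, map_smul, hc] }
  refine ⟨q, ?_⟩
  have hp : p = Sigma.desc ι ≫ q := by
    refine Sigma.hom_ext _ _ fun i => ?_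
    rw [Sigma.ι_desc_assoc]
    refine NatTrans.ext (funext fun H => ModuleCat.hom_ext
      (Finsupp.lhom_ext' fun φ => LinearMap.ext_ring ?_))
    change c i H φ = Finsupp.linearCombination k _ (Finsupp.mapDomain _ (Finsupp.single φ 1))
    rw [Finsupp.mapDomain_single, Finsupp.linearCombination_single, one_smul]
  have : Epi (Sigma.desc ι ≫ q) := hp ▸ inferInstance
  exact epi_of_epi (Sigma.desc ι) q

/-- The values of a smallish module have the dimension of a quotient of stable subspaces of free
modules on sets of contractions to graphs with at most `d` edges. -/
theorem IsSmallish.exists_submodules {M : GraphModule k g} (hM : M.IsSmallish d) :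
    ∃ (n : ℕ) (Y : Fin n → GenusGraph g), (∀ i, (Y i).graph.numEdges ≤ d) ∧
      ∃ A B : ∀ H : GenusGraph g, Submodule k ((Σ i, (H ⟶ Y i)) →₀ k),
        (∀ {H H' : GenusGraph g} (f : H' ⟶ H), ∀ x ∈ A H,
          x.mapDomain (fun φ => (⟨φ.1, f ≫ φ.2⟩ : Σ i, (H' ⟶ Y i))) ∈ A H') ∧
        (∀ {H H' : GenusGraph g} (f : H' ⟶ H), ∀ x ∈ B H,
          x.mapDomain (fun φ => (⟨φ.1, f ≫ φ.2⟩ : Σ i, (H' ⟶ Y i))) ∈ B H') ∧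
        ∀ H : GenusGraph g, Finite (Σ i, (H ⟶ Y i)) →
          Module.Finite k (M.obj (op H)) ∧
          Module.finrank k (M.obj (op H)) + Module.finrank k (B H) = Module.finrank k (A H) := by
  obtain ⟨F, N, S, ι, p, ⟨n, Y, hY, p', hp'⟩, hι, hp⟩ := hM
  obtain ⟨q, hq⟩ := exists_principalSum_epi p'
  have hqs : ∀ H, Function.Surjective (q.app H).hom := fun H =>
    (ModuleCat.epi_iff_surjective _).1 inferInstance
  have hps : ∀ H, Function.Surjective (p.app H).hom := fun H =>
    (ModuleCat.epi_iff_surjective _).1 inferInstance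
  have hιi : ∀ H, Function.Injective (ι.app H).hom := fun H =>
    (ModuleCat.mono_iff_injective _).1 inferInstance
  have hqn : ∀ {H H' : GenusGraph g} (f : H' ⟶ H) (x : (Σ i, (H ⟶ Y i)) →₀ k),
      (q.app (op H')).hom (x.mapDomain (fun φ => (⟨φ.1, f ≫ φ.2⟩ : Σ i, (H' ⟶ Y i)))) =
        (N.map f.op).hom ((q.app (op H)).hom x) := fun f x =>
    congrArg (fun α => α.hom x) (q.naturality f.op)
  have hιn : ∀ {H H' : GenusGraph g} (f : H' ⟶ H) (x : S.obj (op H)),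
      (ι.app (op H')).hom ((S.map f.op).hom x) = (N.map f.op).hom ((ι.app (op H)).hom x) :=
    fun f x => congrArg (fun α => α.hom x) (ι.naturality f.op)
  have hpn : ∀ {H H' : GenusGraph g} (f : H' ⟶ H) (x : S.obj (op H)),
      (p.app (op H')).hom ((S.map f.op).hom x) = (F.gr.map f.op).hom ((p.app (op H)).hom x) :=
    fun f x => congrArg (fun α => α.hom x) (p.naturality f.op)
  -- `A` is the preimage of the submodule `S` of `N`, and `B` the preimage of the kernel of `S ⟶
  -- gr`. Both contain the kernel of `q`, whose dimension cancels in the difference.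
  refine ⟨n, Y, hY, fun H => (LinearMap.range (ι.app (op H)).hom).comap (q.app (op H)).hom,
    fun H => ((LinearMap.ker (p.app (op H)).hom).map (ι.app (op H)).hom).comap
      (q.app (op H)).hom, ?_, ?_, ?_⟩
  · rintro H H' f x ⟨s, hs⟩
    exact ⟨(S.map f.op).hom s, (hιn f s).trans ((congrArg _ hs).trans (hqn f x).symm)⟩
  · rintro H H' f x ⟨s, hs0, hs⟩
    refine ⟨(S.map f.op).hom s, ?_, (hιn f s).trans ((congrArg _ hs).trans (hqn f x).symm)⟩
    have h0 : (p.app (op H)).hom s = 0 := hs0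
    change (p.app (op H')).hom _ = 0
    rw [hpn, h0, map_zero]
  · intro H hH
    have hE : FiniteDimensional k ((principalSum k Y).obj (op H)) :=
      inferInstanceAs (Module.Finite k ((Σ i, (H ⟶ Y i)) →₀ k))
    have hN : Module.Finite k (N.obj (op H)) := Module.Finite.of_surjective _ (hqs _)
    have hS : Module.Finite k (S.obj (op H)) := Module.Finite.of_injective _ (hιi _)
    have hgr : Module.Finite k (F.gr.obj (op H)) := Module.Finite.of_surjective _ (hps _)
    obtain ⟨h1, h2⟩ := finite_and_finrank_eq_gr F (op H)
    refine ⟨h1, ?_⟩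
    have h3 := finrank_comap_eq_add_ker _ (hqs (op H)) (LinearMap.range (ι.app (op H)).hom)
    have h4 := finrank_comap_eq_add_ker _ (hqs (op H))
      ((LinearMap.ker (p.app (op H)).hom).map (ι.app (op H)).hom)
    rw [LinearMap.finrank_range_of_inj (hιi _)] at h3
    rw [← (Submodule.equivMapOfInjective _ (hιi (op H)) _).finrank_eq] at h4
    have h5 := LinearMap.finrank_range_add_finrank_ker (p.app (op H)).hom
    rw [LinearMap.range_eq_top.2 (hps _), finrank_top] at h5
    rw [h2]
    refine Eq.trans ?_ h3.symm
    refine (congrArg _ h4).trans ?_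
    omega

end GraphModule

/-! ### Families of graphs with blocks of edges, and contractions out of them -/

theorem Slot.insertAt_lt_add_single {r : ℕ} {m m' : Fin r → ℕ} {i : Fin r} (p : ℕ)
    (hm : m' = m + Pi.single i 1) {a : Slot r} (ha : (ofLex a).2 < m (ofLex a).1) :
    (ofLex (Slot.insertAt i p a)).2 < m' (ofLex (Slot.insertAt i p a)).1 := by
  obtain ⟨⟨j, t⟩, rfl⟩ := toLex.surjective a
  rw [Slot.insertAt_toLex]
  simp only [ofLex_toLex] at ha ⊢
  rw [hm, Pi.add_apply, Pi.single_apply]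
  split_ifs <;> grind

/-- A slot below the new size is the inserted one or comes from a slot below the old size. -/
theorem Slot.eq_or_exists_insertAt {r : ℕ} {m m' : Fin r → ℕ} {i : Fin r} {p : ℕ}
    (hm : m' = m + Pi.single i 1) (hp : p ≤ m i) {a : Slot r}
    (ha : (ofLex a).2 < m' (ofLex a).1) :
    a = toLex (i, p) ∨ ∃ b : Slot r, (ofLex b).2 < m (ofLex b).1 ∧ Slot.insertAt i p b = a := by
  obtain ⟨⟨j, t⟩, rfl⟩ := toLex.surjective a
  simp only [ofLex_toLex] at ha
  rw [hm, Pi.add_apply, Pi.single_apply] at ha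
  by_cases h : j = i
  · subst h
    rw [if_pos rfl] at ha
    rcases lt_trichotomy t p with htp | rfl | htp
    · refine Or.inr ⟨toLex (j, t), htp.trans_le hp, ?_⟩
      rw [Slot.insertAt_toLex, if_neg (by omega)]
    · exact Or.inl rfl
    · refine Or.inr ⟨toLex (j, t - 1), show t - 1 < m j by omega, ?_⟩
      rw [Slot.insertAt_toLex, if_pos ⟨rfl, by omega⟩, Nat.sub_add_cancel (by omega)]
  · rw [if_neg h, add_zero] at ha
    refine Or.inr ⟨toLex (j, t), ha, ?_⟩
    rw [Slot.insertAt_toLex, if_neg (by tauto)]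

/-- A family of graphs of genus `g`, consisting of a fixed part and `r` blocks of edges of variable
sizes, together with contractions which remove a single edge of a block. -/
structure GraphFamily (g r : ℕ) where
  Index : Type
  graph : Index → GenusGraph g
  size : Index → Fin r → ℕ
  size_injective : Function.Injective size
  exists_size_eq_add_single : ∀ x i, ∃ y, size y = size x + Pi.single i 1
  V : Type
  E : Type
  finV : Finite V
  finE : Finite E
  vert : ∀ x, V → (graph x).graph.Vert
  dart : ∀ x, E → (graph x).graph.Dart
  slot : ∀ x (a : Slot r), (ofLex a).2 < size x (ofLex a).1 → (graph x).graph.Dart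
  slot_injective : ∀ x a b ha hb, slot x a ha = slot x b hb → a = b
  slot_ne_rev : ∀ x a b ha hb, slot x a ha ≠ (graph x).graph.rev (slot x b hb)
  hom_ext : ∀ x {H : CWGraph} (φ ψ : CWGraph.Hom (graph x).graph H),
    (∀ v, φ.onVert (vert x v) = ψ.onVert (vert x v)) →
    (∀ e, φ.onDart (dart x e) = ψ.onDart (dart x e)) →
    (∀ a ha, φ.onDart (slot x a ha) = ψ.onDart (slot x a ha)) → φ = ψ
  exists_contraction : ∀ x y i p, size y = size x + Pi.single i 1 → p ≤ size x i →
    ∃ f : graph y ⟶ graph x, (∀ v, f.hom.onVert (vert y v) = vert x v) ∧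
      (∀ e, f.hom.onDart (dart y e) = some (dart x e)) ∧
      (∀ h, f.hom.onDart (slot y (toLex (i, p)) h) = none) ∧
      ∀ a ha ha', f.hom.onDart (slot y (Slot.insertAt i p a) ha') = some (slot x a ha)

namespace GraphFamily

attribute [instance] GraphFamily.finV GraphFamily.finE

variable {g r : ℕ} (Γ : GraphFamily g r) {H : CWGraph}

open Classical in
/-- The image of the edge in a slot; `none` if the edge is contracted or there is no such slot. -/
noncomputable def color (x : Γ.Index) (φ : CWGraph.Hom (Γ.graph x).graph H) (a : Slot r) :
    Option H.Dart :=
  if h : (ofLex a).2 < Γ.size x (ofLex a).1 then φ.onDart (Γ.slot x a h) else none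

theorem finite_color_ne_none (x : Γ.Index) (φ : CWGraph.Hom (Γ.graph x).graph H) :
    {a | Γ.color x φ a ≠ none}.Finite := by
  classical
  refine Set.Finite.subset (Finset.finite_toSet (Finset.univ.biUnion fun i : Fin r =>
    (Finset.range (Γ.size x i)).image fun t => (toLex (i, t) : Slot r))) fun a ha => ?_
  obtain ⟨⟨i, t⟩, rfl⟩ := toLex.surjective a
  simp only [Finset.coe_biUnion, Set.mem_iUnion, Finset.mem_coe, Finset.mem_image]
  refine ⟨i, Finset.mem_univ i, t, Finset.mem_range.2 ?_, rfl⟩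
  by_contra h
  exact ha (dif_neg h)

/-- The slots whose edges are not contracted. -/
noncomputable def supp (x : Γ.Index) (φ : CWGraph.Hom (Γ.graph x).graph H) : Finset (Slot r) :=
  (Γ.finite_color_ne_none x φ).toFinset

variable {Γ}

theorem mem_supp {x : Γ.Index} {φ : CWGraph.Hom (Γ.graph x).graph H} {a : Slot r} :
    a ∈ Γ.supp x φ ↔ Γ.color x φ a ≠ none :=
  (Γ.finite_color_ne_none x φ).mem_toFinset

theorem mem_supp' {x : Γ.Index} {φ : CWGraph.Hom (Γ.graph x).graph H} {a : Slot r} :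
    a ∈ Γ.supp x φ ↔ ∃ ha d, φ.onDart (Γ.slot x a ha) = some d := by
  rw [mem_supp, color]
  split_ifs with h
  · simp [h, Option.ne_none_iff_exists']
  · simp [h]

/-- Each directed edge of `H` has exactly one preimage under a contraction. The surviving slots,
taken in both directions, therefore inject into the directed edges of `H`, and there are twice as
many of these as edges. -/
theorem card_supp_le {x : Γ.Index} {φ : CWGraph.Hom (Γ.graph x).graph H} (hφ : φ.IsContraction) :
    (Γ.supp x φ).card ≤ H.numEdges := by
  choose ha c hc using fun a : Γ.supp x φ => mem_supp'.1 a.2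
  have hinj : Function.Injective fun z : Γ.supp x φ × Bool =>
      if z.2 then c z.1 else H.rev (c z.1) := by
    have hc' := fun a => φ.onDart_rev_some (hc a)
    rintro ⟨a, b⟩ ⟨a', b'⟩ h
    have huniq : ∀ {d d' e}, φ.onDart d = some e → φ.onDart d' = some e → d = d' :=
      fun {d d' e} h h' => (hφ.2 e).unique h h'
    cases b <;> cases b' <;> simp only [if_true, Bool.false_eq_true, if_false] at h
    · have h1 := congrArg H.rev h
      rw [H.rev_rev, H.rev_rev] at h1
      have h2 := huniq (hc a) ((hc a').trans (congrArg some h1.symm))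
      rw [Subtype.ext (Γ.slot_injective x _ _ _ _ h2)]
    · exact absurd (huniq (hc a') ((hc' a).trans (congrArg some h))) (Γ.slot_ne_rev x _ _ _ _)
    · exact absurd (huniq (hc a) ((hc' a').trans (congrArg some h.symm)))
        (Γ.slot_ne_rev x _ _ _ _)
    · have h2 := huniq (hc a) ((hc a').trans (congrArg some h.symm))
      rw [Subtype.ext (Γ.slot_injective x _ _ _ _ h2)]
  have h1 := Nat.card_le_card_of_injective _ hinj
  have h2 := H.two_mul_numEdges
  rw [Nat.card_prod, Nat.card_eq_fintype_card, Nat.card_eq_fintype_card, Fintype.card_coe,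
    Fintype.card_bool] at h1
  omega

variable (Γ)

/-- The images of the edges in slots which are not contracted, in the order of the slots. -/
noncomputable def colors (x : Γ.Index) (φ : CWGraph.Hom (Γ.graph x).graph H) :
    List (Option H.Dart) :=
  (Γ.supp x φ).sort.map (Γ.color x φ)

theorem length_colors (x : Γ.Index) (φ : CWGraph.Hom (Γ.graph x).graph H) :
    (Γ.colors x φ).length = (Γ.supp x φ).card := by
  simp [colors]

variable {Γ}

/-- The word lists the colours along the sorted support, so word and support recover every colour;
off the support the colour is `none`. -/
theorem color_eq_of_colors_eq {x : Γ.Index} {φ ψ : CWGraph.Hom (Γ.graph x).graph H}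
    (hs : Γ.supp x φ = Γ.supp x ψ) (hc : Γ.colors x φ = Γ.colors x ψ) :
    Γ.color x φ = Γ.color x ψ := by
  funext a
  by_cases ha : a ∈ Γ.supp x φ
  · unfold colors at hc
    rw [← hs] at hc
    exact List.map_inj_left.1 hc a ((Finset.mem_sort _).2 ha)
  · have h1 := mem_supp.not_left.1 ha
    have h2 := mem_supp.not_left.1 (hs ▸ ha)
    rw [h1, h2]

section Insert

variable {x y : Γ.Index} {i : Fin r} {p : ℕ} (hxy : Γ.size y = Γ.size x + Pi.single i 1)
  (hp : p ≤ Γ.size x i) {f : Γ.graph y ⟶ Γ.graph x}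
  (hnone : ∀ h, f.hom.onDart (Γ.slot y (toLex (i, p)) h) = none)
  (hslot : ∀ a ha ha', f.hom.onDart (Γ.slot y (Slot.insertAt i p a) ha') = some (Γ.slot x a ha))
  (φ : CWGraph.Hom (Γ.graph x).graph H)

include hxy hslot in
theorem color_comp_insertAt {a : Slot r} (ha : (ofLex a).2 < Γ.size x (ofLex a).1) :
    Γ.color y (f.hom.comp φ) (Slot.insertAt i p a) = Γ.color x φ a := by
  have ha' := Slot.insertAt_lt_add_single p hxy ha
  rw [color, color, dif_pos ha', dif_pos ha, CWGraph.Hom.comp_of_some _ _ (hslot a ha ha')]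

include hxy hp hnone hslot in
-- The only slot not of the form `Slot.insertAt i p b` is slot `p` of block `i`, and `f` contracts
-- its edge.
theorem supp_comp : Γ.supp y (f.hom.comp φ) = (Γ.supp x φ).image (Slot.insertAt i p) := by
  ext a
  rw [Finset.mem_image]
  constructor
  · intro h
    obtain ⟨ha, d, hd⟩ := mem_supp'.1 h
    rcases Slot.eq_or_exists_insertAt hxy hp ha with rfl | ⟨b, hb, rfl⟩
    · rw [CWGraph.Hom.comp_none_of_none _ _ (hnone _)] at hd
      cases hd
    · refine ⟨b, mem_supp.2 ?_, rfl⟩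
      rw [← color_comp_insertAt hxy hslot φ hb]
      exact mem_supp.1 h
  · rintro ⟨b, hb, rfl⟩
    obtain ⟨hb', -⟩ := mem_supp'.1 hb
    rw [mem_supp, color_comp_insertAt hxy hslot φ hb']
    exact mem_supp.1 hb

include hxy hp hnone hslot in
-- Insertion preserves both the order of the surviving slots and their colours, so the word does not
-- change. This makes the word usable as part of a label.
theorem colors_comp : Γ.colors y (f.hom.comp φ) = Γ.colors x φ := by
  have hmono := Slot.insertAt_strictMono i p
  have h1 := (hmono.strictMonoOn (Γ.supp x φ : Set (Slot r)))
  unfold colors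
  have h2 : Γ.supp y (f.hom.comp φ) = (Γ.supp x φ).map ⟨Slot.insertAt i p, hmono.injective⟩ := by
    rw [supp_comp hxy hp hnone hslot φ, Finset.map_eq_image]
    rfl
  have h3 := StrictMonoOn.map_finsetSort ⟨Slot.insertAt i p, hmono.injective⟩ (Γ.supp x φ) h1
  rw [h2, ← h3, List.map_map]
  refine List.map_congr_left fun a ha => ?_
  obtain ⟨ha', -⟩ := mem_supp'.1 ((Finset.mem_sort _).1 ha)
  exact color_comp_insertAt hxy hslot φ ha'

end Insert

theorem _root_.GenusGraph.finite_hom (G H : GenusGraph g) : Finite (G ⟶ H) :=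
  Finite.of_injective (fun φ : G ⟶ H => (φ.hom.onVert, φ.hom.onDart)) fun _ _ h =>
    GenusGraph.Contraction.ext (CWGraph.Hom.ext (Prod.mk.inj h).1 (Prod.mk.inj h).2)

/-- The dimensions of a smallish module on a family of graphs are eventually polynomial. -/
theorem exists_polynomial (Γ : GraphFamily g r) {k : Type u} [Field k] {d : ℕ}
    {M : GraphModule k g} (hM : M.IsSmallish d) :
    ∃ f : MvPolynomial (Fin r) ℚ, f.totalDegree ≤ d ∧
      ∃ N : ℕ, ∀ x, (∀ i, N ≤ Γ.size x i) →
        Module.Finite k (M.obj (op (Γ.graph x))) ∧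
        (Module.finrank k (M.obj (op (Γ.graph x))) : ℚ) =
          MvPolynomial.eval (fun i => (Γ.size x i : ℚ)) f := by
  obtain ⟨n, Y, hY, A, B, hA, hB, hAB⟩ := hM.exists_submodules
  have hfin : ∀ x, Finite (Σ i, (Γ.graph x ⟶ Y i)) := fun x =>
    have := fun i => GenusGraph.finite_hom (Γ.graph x) (Y i)
    inferInstance
  -- The label consists of the target, the values on the fixed part and the word of colours. Words
  -- have length at most `d`, so there are finitely many labels, independently of the sizes.
  let T := Σ i : Fin n, (Γ.V → (Y i).graph.Vert) × (Γ.E → Option (Y i).graph.Dart) ×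
    {l : List (Option (Y i).graph.Dart) // l.length ≤ d}
  have hT : Finite T := by
    have : ∀ i, Finite {l : List (Option (Y i).graph.Dart) // l.length ≤ d} := fun i =>
      (List.finite_length_le _ d).to_subtype
    infer_instance
  have hcard : ∀ x (b : Σ i, (Γ.graph x ⟶ Y i)), (Γ.supp x b.2.hom).card ≤ d := fun x b =>
    (card_supp_le b.2.isContraction).trans (hY b.1)
  let label : ∀ x, (Σ i, (Γ.graph x ⟶ Y i)) → T := fun x b =>
    ⟨b.1, fun v => b.2.hom.onVert (Γ.vert x v), fun e => b.2.hom.onDart (Γ.dart x e),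
      ⟨Γ.colors x b.2.hom, (Γ.length_colors x _).trans_le (hcard x b)⟩⟩
  have key : ∀ W : ∀ H : GenusGraph g, Submodule k ((Σ i, (H ⟶ Y i)) →₀ k),
      (∀ {H H' : GenusGraph g} (f : H' ⟶ H), ∀ w ∈ W H,
        w.mapDomain (fun φ => (⟨φ.1, f ≫ φ.2⟩ : Σ i, (H' ⟶ Y i))) ∈ W H') →
      ∃ P : (Fin r → ℕ) → ℚ, EventuallyPolynomial d P ∧ ∀ x, (∀ i, d ≤ Γ.size x i) →
        (Module.finrank k (W (Γ.graph x)) : ℚ) = P (Γ.size x) := by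
    intro W hW
    refine Slot.eventuallyPolynomial_finrank Γ.size Γ.size_injective Γ.exists_size_eq_add_single
      (fun x => Σ i, (Γ.graph x ⟶ Y i)) label (fun x b => Γ.supp x b.2.hom) ?_ ?_ hcard
      (fun x => W (Γ.graph x)) ?_
    · rintro x ⟨i, φ⟩ ⟨i', ψ⟩ h hs
      obtain rfl : i = i' := congrArg Sigma.fst h
      have h := eq_of_heq (Sigma.mk.inj h).2
      simp only [Prod.mk.injEq, Subtype.mk.injEq] at h
      obtain ⟨h1, h2, h3⟩ := h
      have h4 := color_eq_of_colors_eq hs h3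
      congr 1
      refine GenusGraph.Contraction.ext (Γ.hom_ext x _ _ (congrFun h1) (congrFun h2) ?_)
      intro a ha
      have := congrFun h4 a
      rwa [color, color, dif_pos ha, dif_pos ha] at this
    · intro x b i t h
      obtain ⟨h, -⟩ := mem_supp'.1 h
      exact h
    · intro x y i p hxy hp
      obtain ⟨f, h1, h2, h3, h4⟩ := Γ.exists_contraction x y i p hxy hp
      refine ⟨fun φ => ⟨φ.1, f ≫ φ.2⟩, fun b => ?_, fun b => ?_, fun w hw => hW f w hw⟩
      · refine Sigma.ext rfl (heq_of_eq (Prod.ext ?_ (Prod.ext ?_ (Subtype.ext ?_))))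
        · funext v
          exact congrArg b.2.hom.onVert (h1 v)
        · funext e
          exact CWGraph.Hom.comp_of_some f.hom b.2.hom (h2 e)
        · exact colors_comp hxy hp h3 h4 b.2.hom
      · exact supp_comp hxy hp h3 h4 b.2.hom
  obtain ⟨P, hP, hPA⟩ := key A hA
  obtain ⟨P', hP', hPB⟩ := key B hB
  obtain ⟨f, hf, N, hN⟩ := hP.sub hP'
  refine ⟨f, hf, max N d, fun x hx => ?_⟩
  obtain ⟨h1, h2⟩ := hAB (Γ.graph x) (hfin x)
  refine ⟨h1, ?_⟩
  have hxd : ∀ i, d ≤ Γ.size x i := fun i => (le_max_right _ _).trans (hx i)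
  rw [← hN _ fun i => (le_max_left _ _).trans (hx i)]
  beta_reduce
  rw [← hPA x hxd, ← hPB x hxd, ← h2]
  push_cast
  ring

end GraphFamily

/-! ### Recognising the contraction of a single edge -/

namespace CWGraph

/-- The image of a directed edge and of its origin determine the image of its terminus, whether or
not the edge is contracted. This propagates agreement of two morphisms along paths. -/
theorem Hom.onVert_tgt_eq {G H : CWGraph} {φ ψ : Hom G H} {d : G.Dart}
    (hd : φ.onDart d = ψ.onDart d) (hs : φ.onVert (G.src d) = ψ.onVert (G.src d)) :
    φ.onVert (G.tgt d) = ψ.onVert (G.tgt d) := by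
  cases h : φ.onDart d with
  | none => rw [← φ.contracted d h, ← ψ.contracted d (hd ▸ h), hs]
  | some d' => rw [← φ.tgt_onDart h, ← ψ.tgt_onDart (hd ▸ h)]

/-- A morphism of graphs of the same genus which contracts exactly one edge, and this is not a
loop, is a contraction. -/
theorem Hom.isContraction_of_contracts_single_edge {G H : CWGraph} {g : ℕ} (hG : G.HasGenus g)
    (hH : H.HasGenus g) (φ : Hom G H) (d₀ : G.Dart) (hd₀ : G.src d₀ ≠ G.tgt d₀)
    (hV : Function.Surjective φ.onVert) (hD : ∀ d', ∃! d, φ.onDart d = some d')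
    (hnone : ∀ d, φ.onDart d = none ↔ d = d₀ ∨ d = G.rev d₀) : φ.IsContraction := by
  classical
  have h₀ : φ.onVert (G.src d₀) = φ.onVert (G.tgt d₀) :=
    φ.contracted d₀ ((hnone d₀).2 (Or.inl rfl))
  have hcardD : Nat.card G.Dart = Nat.card H.Dart + 2 := by
    choose s hs hs' using hD
    have : Nat.card (H.Dart ⊕ Bool) = Nat.card G.Dart := by
      refine Nat.card_eq_of_bijective
        (Sum.elim s fun b => if b then d₀ else G.rev d₀) ⟨?_, ?_⟩
      · have hne : ∀ d', φ.onDart (s d') ≠ none := fun d' h => by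
          rw [show φ.onDart (s d') = some d' from hs d'] at h
          cases h
        rintro (a | a) (b | b) h
        · have h1 : some a = some b := (hs a).symm.trans ((congrArg φ.onDart h).trans (hs b))
          cases h1
          rfl
        · refine absurd ((hnone (s a)).2 ?_) (hne a)
          cases b
          · exact Or.inr h
          · exact Or.inl h
        · refine absurd ((hnone (s b)).2 ?_) (hne b)
          cases a
          · exact Or.inr h.symm
          · exact Or.inl h.symm
        · cases a <;> cases b
          · rfl
          · exact absurd h (G.rev_ne d₀)
          · exact absurd h.symm (G.rev_ne d₀)
          · rfl
      · intro d
        cases h : φ.onDart d with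
        | none =>
          rcases (hnone d).1 h with rfl | rfl
          · exact ⟨Sum.inr true, rfl⟩
          · exact ⟨Sum.inr false, rfl⟩
        | some d' => exact ⟨Sum.inl d', (hs' d' d h).symm⟩
    rw [← this, Nat.card_sum, Nat.card_eq_fintype_card (α := Bool), Fintype.card_bool]
  -- Equal genus turns the loss of one edge into the loss of one vertex.
  have hcardV : Nat.card G.Vert = Nat.card H.Vert + 1 := by
    have h1 := G.two_mul_numEdges
    have h2 := H.two_mul_numEdges
    have h3 := hG.2
    have h4 := hH.2
    unfold genus at h3 h4
    omega
  -- With the terminus of `d₀` left out, `φ` is still surjective on vertices, now between sets of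
  -- equal size, hence injective. So the ends of `d₀` are the only two vertices identified.
  have hinj : ∀ u v, u ≠ G.tgt d₀ → v ≠ G.tgt d₀ → φ.onVert u = φ.onVert v → u = v := by
    let ρ : {u // u ≠ G.tgt d₀} → H.Vert := fun u => φ.onVert u.1
    have hρ : Function.Surjective ρ := by
      intro w
      obtain ⟨u, hu⟩ := hV w
      by_cases h : u = G.tgt d₀
      · exact ⟨⟨G.src d₀, hd₀⟩, h₀.trans (h ▸ hu)⟩
      · exact ⟨⟨u, h⟩, hu⟩
    have hc : Nat.card {u // u ≠ G.tgt d₀} = Nat.card H.Vert := by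
      have := Fintype.ofFinite G.Vert
      rw [Nat.card_eq_fintype_card] at hcardV ⊢
      rw [Fintype.card_subtype_compl, Fintype.card_subtype_eq]
      omega
    have := (Nat.bijective_iff_surjective_and_card ρ).2 ⟨hρ, hc⟩
    intro u v hu hv h
    exact congrArg Subtype.val (this.1 (a₁ := ⟨u, hu⟩) (a₂ := ⟨v, hv⟩) h)
  have hpair : ∀ u v, φ.onVert u = φ.onVert v → u = v ∨ (u = G.src d₀ ∧ v = G.tgt d₀) ∨
      (u = G.tgt d₀ ∧ v = G.src d₀) := by
    intro u v h
    by_cases hu : u = G.tgt d₀ <;> by_cases hv : v = G.tgt d₀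
    · exact Or.inl (hu.trans hv.symm)
    · exact Or.inr (Or.inr ⟨hu, hinj v _ hv hd₀ (h.symm.trans ((congrArg _ hu).trans h₀.symm))⟩)
    · exact Or.inr (Or.inl ⟨hinj u _ hu hd₀ (h.trans ((congrArg _ hv).trans h₀.symm)), hv⟩)
    · exact Or.inl (hinj u v hu hv h)
  refine ⟨fun w => ⟨⟨?_, ?_⟩, ?_⟩, hD⟩
  · obtain ⟨u, hu⟩ := hV w
    exact ⟨⟨u, hu⟩⟩
  · rintro ⟨u, hu⟩ ⟨v, hv⟩
    rcases hpair u v (hu.trans hv.symm) with rfl | ⟨rfl, rfl⟩ | ⟨rfl, rfl⟩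
    · exact .refl
    · exact .single ⟨⟨d₀, (hnone d₀).2 (Or.inl rfl), hu⟩, rfl, rfl⟩
    · exact .single ⟨⟨G.rev d₀, (hnone _).2 (Or.inr rfl), hu⟩, rfl,
        Subtype.ext (congrArg G.src (G.rev_rev d₀))⟩
  -- The fibre over the image of `d₀` is a single edge with its two ends; every other fibre is a
  -- single vertex.
  · have key : 2 * Nat.card (φ.fiber w).Vert = Nat.card (φ.fiber w).Dart + 2 := by
      by_cases hw : φ.onVert (G.src d₀) = w
      · have h1 : Nat.card (φ.fiber w).Vert = 2 := by
          refine Nat.card_eq_two_iff.2 ⟨⟨G.src d₀, hw⟩, ⟨G.tgt d₀, h₀.symm.trans hw⟩,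
            fun h => hd₀ (congrArg Subtype.val h), Set.eq_univ_of_forall ?_⟩
          rintro ⟨u, hu⟩
          rcases hpair u _ (hu.trans hw.symm) with rfl | ⟨rfl, _⟩ | ⟨rfl, _⟩
          · exact Or.inl rfl
          · exact Or.inl rfl
          · exact Or.inr rfl
        have h2 : Nat.card (φ.fiber w).Dart = 2 := by
          refine Nat.card_eq_two_iff.2 ⟨⟨d₀, (hnone d₀).2 (Or.inl rfl), hw⟩,
            ⟨G.rev d₀, (hnone _).2 (Or.inr rfl), h₀.symm.trans hw⟩,
            fun h => G.rev_ne d₀ (congrArg Subtype.val h).symm, Set.eq_univ_of_forall ?_⟩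
          rintro ⟨d, hd, hdw⟩
          rcases (hnone d).1 hd with rfl | rfl
          · exact Or.inl rfl
          · exact Or.inr rfl
        rw [h1, h2]
      · obtain ⟨u, hu⟩ := hV w
        have h1 : Nat.card (φ.fiber w).Vert = 1 := by
          refine Nat.card_eq_one_iff_unique.2 ⟨⟨?_⟩, ⟨⟨u, hu⟩⟩⟩
          rintro ⟨u, hu⟩ ⟨v, hv⟩
          rcases hpair u v (hu.trans hv.symm) with rfl | ⟨rfl, _⟩ | ⟨_, rfl⟩
          · rfl
          · exact absurd hu hw
          · exact absurd hv hw
        have h2 : Nat.card (φ.fiber w).Dart = 0 := by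
          have : IsEmpty (φ.fiber w).Dart := ⟨fun ⟨d, hd, hdw⟩ => by
            rcases (hnone d).1 hd with rfl | rfl
            · exact hw hdw
            · exact hw (h₀.trans hdw)⟩
          exact Nat.card_of_isEmpty
        rw [h1, h2]
    have h1 := (φ.fiber w).two_mul_numEdges
    unfold genus
    omega

end CWGraph

/-! ### Renumbering of a block when one edge is removed -/

/-- The position to which position `t` of block `j` moves when the edge in position `p` of block
`i` is removed. -/
def collapsePos {r : ℕ} (i : Fin r) (p : ℕ) (j : Fin r) (t : ℕ) : ℕ :=
  if j = i ∧ p < t then t - 1 else t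

section CollapseSlot

variable {r : ℕ} {m m' : Fin r → ℕ} {i : Fin r} (hm : ∀ j, m' j = m j + if j = i then 1 else 0)
  {p : ℕ} (hp : p ≤ m i)

include hm in
theorem collapsePos_last (hp : p ≤ m i) (j : Fin r) : collapsePos i p j (m' j) = m j := by
  have := hm j
  unfold collapsePos
  grind

include hm hp in
theorem collapsePos_lt {j : Fin r} {t : ℕ} (ht : t < m' j) (h : ¬(j = i ∧ t = p)) :
    collapsePos i p j t < m j := by
  have := hm j
  unfold collapsePos
  grind

/-- On a path, edge `t` joins positions `t` and `t + 1`. The ends of a surviving edge remain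
consecutive, whereas those of the removed edge merge (`collapsePos_succ_self`). -/
theorem collapsePos_succ {j : Fin r} {t : ℕ} (h : ¬(j = i ∧ t = p)) :
    collapsePos i p j (t + 1) = collapsePos i p j t + 1 := by
  unfold collapsePos
  grind

/-- Away from the removed edge, renumbering is inverse to the shift in `Slot.insertAt`. -/
theorem collapsePos_eq_iff {j : Fin r} {t s : ℕ} (h : ¬(j = i ∧ t = p)) :
    collapsePos i p j t = s ↔ t = if j = i ∧ p ≤ s then s + 1 else s := by
  unfold collapsePos
  grind

theorem collapsePos_succ_self : collapsePos i p i (p + 1) = collapsePos i p i p := by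
  unfold collapsePos
  grind

/-- The removal of the edge in position `p` of block `i`. -/
def collapseSlot (x : Σ j, Fin (m' j)) : Option (Σ j, Fin (m j)) :=
  if h : x.1 = i ∧ (x.2 : ℕ) = p then none
  else some ⟨x.1, ⟨collapsePos i p x.1 x.2, collapsePos_lt hm hp x.2.2 h⟩⟩

theorem collapseSlot_eq_none {x : Σ j, Fin (m' j)} :
    collapseSlot hm hp x = none ↔ x.1 = i ∧ (x.2 : ℕ) = p := by
  unfold collapseSlot
  split_ifs with h <;> simp [h]

theorem collapseSlot_eq_some {x : Σ j, Fin (m' j)} {y : Σ j, Fin (m j)} :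
    collapseSlot hm hp x = some y ↔ x.1 = y.1 ∧
      (x.2 : ℕ) = if y.1 = i ∧ p ≤ (y.2 : ℕ) then (y.2 : ℕ) + 1 else y.2 := by
  obtain ⟨j, t⟩ := x
  obtain ⟨l, s⟩ := y
  by_cases h : j = i ∧ (t : ℕ) = p
  · rw [(collapseSlot_eq_none hm hp (x := ⟨j, t⟩)).2 h]
    obtain ⟨rfl, h⟩ := h
    simp only [reduceCtorEq, false_iff, not_and]
    rintro rfl
    grind
  · unfold collapseSlot
    rw [dif_neg h, Option.some.injEq]
    constructor
    · intro heq
      cases heq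
      exact ⟨rfl, (collapsePos_eq_iff h).1 rfl⟩
    · rintro ⟨h1, h2⟩
      dsimp only at h1
      subst h1
      exact congrArg (Sigma.mk j) (Fin.ext ((collapsePos_eq_iff h).2 h2))

theorem existsUnique_collapseSlot (y : Σ j, Fin (m j)) :
    ∃! x : Σ j, Fin (m' j), collapseSlot hm hp x = some y := by
  obtain ⟨l, s⟩ := y
  simp only [collapseSlot_eq_some]
  have := hm l
  have hs := s.2
  refine ⟨⟨l, ⟨if l = i ∧ p ≤ (s : ℕ) then (s : ℕ) + 1 else s, by grind⟩⟩, ⟨rfl, rfl⟩, ?_⟩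
  rintro ⟨j, t⟩ ⟨rfl, ht⟩
  congr 1
  exact Fin.ext ht

end CollapseSlot

/-! ### Contraction of a sprouted edge and of an edge of a subdivided path -/

namespace CWGraph

section Sprout

variable (G : CWGraph) {r : ℕ} (v : Fin r → G.Vert) {m m' : Fin r → ℕ} {i : Fin r}
  (hm : ∀ j, m' j = m j + if j = i then 1 else 0) {p : ℕ} (hp : p ≤ m i)

/-- The contraction of the `p`-th new edge at `v i`. -/
def sproutCollapse : Hom (G.sprout v m') (G.sprout v m) where
  onVert := Sum.elim Sum.inl fun x => (collapseSlot hm hp x).elim (Sum.inl (v x.1)) Sum.inr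
  onDart := Sum.elim (fun d => some (Sum.inl d)) fun x =>
    (collapseSlot hm hp x.1).map fun y => Sum.inr (y, x.2)
  onDart_rev := by
    rintro (d | ⟨x, b⟩)
    · rfl
    · change (collapseSlot hm hp x).map _ = ((collapseSlot hm hp x).map _).map _
      cases collapseSlot hm hp x <;> rfl
  src_onDart := by
    rintro (d | ⟨x, b⟩) d' h
    · cases h
      rfl
    · change (collapseSlot hm hp x).map _ = _ at h
      cases hx : collapseSlot hm hp x with
      | none =>
        rw [hx] at h
        cases h
      | some y =>
        rw [hx] at h
        cases h
        cases b
        · change Sum.inr y = (collapseSlot hm hp x).elim _ _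
          rw [hx]
          rfl
        · exact congrArg (fun j => Sum.inl (v j)) ((collapseSlot_eq_some hm hp).1 hx).1.symm
  contracted := by
    rintro (d | ⟨x, b⟩) h
    · cases h
    · have hx : collapseSlot hm hp x = none := Option.map_eq_none_iff.1 h
      cases b
      · change (collapseSlot hm hp x).elim (Sum.inl (v x.1)) Sum.inr = Sum.inl (v x.1)
        rw [hx]
        rfl
      · change Sum.inl (v x.1) = (collapseSlot hm hp x).elim (Sum.inl (v x.1)) Sum.inr
        rw [hx]
        rfl

theorem isContraction_sproutCollapse {g : ℕ} (hG : G.HasGenus g) :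
    (G.sproutCollapse v hm hp).IsContraction := by
  have hlt : p < m' i := by
    have := hm i
    rw [if_pos rfl] at this
    omega
  refine Hom.isContraction_of_contracts_single_edge (hG.sprout v m') (hG.sprout v m) _
    (Sum.inr (⟨i, ⟨p, hlt⟩⟩, true)) (fun h => ?_) ?_ ?_ ?_
  · cases h
  · rintro (u | y)
    · exact ⟨Sum.inl u, rfl⟩
    · obtain ⟨x, hx, -⟩ := existsUnique_collapseSlot hm hp y
      refine ⟨Sum.inr x, ?_⟩
      change (collapseSlot hm hp x).elim _ _ = _
      rw [hx]
      rfl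
  · rintro (d | ⟨y, b⟩)
    · refine ⟨Sum.inl d, rfl, ?_⟩
      rintro (d' | ⟨x, b'⟩) h
      · cases h
        rfl
      · obtain ⟨z, -, hz⟩ := Option.map_eq_some_iff.1 h
        cases hz
    · obtain ⟨x, hx, hx'⟩ := existsUnique_collapseSlot hm hp y
      refine ⟨Sum.inr (x, b), congrArg (Option.map _) hx, ?_⟩
      rintro (d' | ⟨x', b'⟩) h
      · cases h
      · obtain ⟨z, hz, hz'⟩ := Option.map_eq_some_iff.1 h
        cases hz'
        rw [hx' x' hz]
  · rintro (d | ⟨x, b⟩)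
    · constructor
      · intro h
        cases h
      · rintro (h | h) <;> cases h
    · refine Option.map_eq_none_iff.trans ((collapseSlot_eq_none hm hp).trans ?_)
      constructor
      · rintro ⟨h1, h2⟩
        obtain ⟨j, t⟩ := x
        dsimp only at h1
        subst h1
        obtain rfl : t = ⟨p, hlt⟩ := Fin.ext h2
        cases b
        · exact Or.inr rfl
        · exact Or.inl rfl
      · rintro (h | h) <;> cases h <;> exact ⟨rfl, rfl⟩

end Sprout

section Subdivide

variable (G : CWGraph) {r : ℕ} (e : Fin r → G.Dart) {m m' : Fin r → ℕ+} {i : Fin r}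
  (hm : ∀ j, (m' j : ℕ) = m j + if j = i then 1 else 0) {p : ℕ} (hp : p ≤ m i)

/-- The effect on vertices of the contraction of the `p`-th edge of the path replacing `e i`. -/
def subdivideCollapseVert (m m' : Fin r → ℕ+) (i : Fin r) (p : ℕ) :
    (G.subdivide e m').Vert → (G.subdivide e m).Vert :=
  Sum.elim Sum.inl fun x => G.pathVert e m x.1 (collapsePos i p x.1 (x.2 + 1))

include hm hp in
-- One formula covers both the old ends of the path and its new inner vertices, so that incidences
-- can be checked without separating these cases.
theorem subdivideCollapseVert_pathVert (j : Fin r) {t : ℕ} (ht : t ≤ m' j) :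
    G.subdivideCollapseVert e m m' i p (G.pathVert e m' j t) =
      G.pathVert e m j (collapsePos i p j t) := by
  rcases Nat.eq_zero_or_pos t with rfl | ht0
  · have : collapsePos i p j 0 = 0 := by simp [collapsePos]
    rw [this]
    rfl
  · rcases ht.lt_or_eq with ht | rfl
    · obtain ⟨s, rfl⟩ : ∃ s, t = s + 1 := ⟨t - 1, by omega⟩
      have h := pathVert_succ G e m' j ⟨s, by omega⟩
      dsimp only at h
      rw [h]
      rfl
    · rw [pathVert_last, collapsePos_last (m := fun j => (m j : ℕ)) (m' := fun j => (m' j : ℕ))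
        hm hp j, pathVert_last]
      rfl

theorem src_subdivide_inr (j : Fin r) (t : Fin (m j)) (b : Bool) :
    (G.subdivide e m).src (Sum.inr (⟨j, t⟩, b)) =
      G.pathVert e m j (if b then (t : ℕ) else (t : ℕ) + 1) :=
  rfl

theorem tgt_subdivide_inr (j : Fin r) (t : Fin (m j)) (b : Bool) :
    (G.subdivide e m).tgt (Sum.inr (⟨j, t⟩, b)) =
      G.pathVert e m j (if b then (t : ℕ) + 1 else (t : ℕ)) := by
  cases b <;> rfl

/-- The contraction of the `p`-th edge of the path which replaces `e i`. -/
def subdivideCollapse : Hom (G.subdivide e m') (G.subdivide e m) where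
  onVert := G.subdivideCollapseVert e m m' i p
  onDart := Sum.elim (fun d => some (Sum.inl d)) fun x =>
    (collapseSlot (m := fun j => (m j : ℕ)) (m' := fun j => (m' j : ℕ)) hm hp x.1).map
      fun y => Sum.inr (y, x.2)
  onDart_rev := by
    rintro (d | ⟨x, b⟩)
    · rfl
    · change (collapseSlot _ _ x).map _ = ((collapseSlot _ _ x).map _).map _
      cases collapseSlot _ _ x <;> rfl
  src_onDart := by
    rintro (d | ⟨⟨j, t⟩, b⟩) d' h
    · cases h
      rfl
    · obtain ⟨y, hy, rfl⟩ := Option.map_eq_some_iff.1 h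
      have h1 : ¬(j = i ∧ (t : ℕ) = p) := fun h1 => by
        cases hy.symm.trans ((collapseSlot_eq_none _ _).2 h1)
      unfold collapseSlot at hy
      rw [dif_neg h1] at hy
      cases hy
      have h2 := t.2
      rw [src_subdivide_inr, src_subdivide_inr, G.subdivideCollapseVert_pathVert e hm hp j
        (by split_ifs <;> omega)]
      cases b
      · simp only [Bool.false_eq_true, if_false, collapsePos_succ h1]
        rfl
      · rfl
  contracted := by
    rintro (d | ⟨⟨j, t⟩, b⟩) h
    · cases h
    · obtain ⟨h1, h2⟩ := (collapseSlot_eq_none _ _).1 (Option.map_eq_none_iff.1 h)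
      dsimp only at h1 h2
      subst h1
      have h3 := t.2
      rw [src_subdivide_inr, tgt_subdivide_inr, G.subdivideCollapseVert_pathVert e hm hp j
        (by split_ifs <;> omega), G.subdivideCollapseVert_pathVert e hm hp j
        (by split_ifs <;> omega), h2]
      cases b <;> simp only [Bool.false_eq_true, if_false, if_true, collapsePos_succ_self] <;> rfl

/-- On a path with at least two edges, every edge has a new inner vertex as one of its ends, and its
other end is different. -/
theorem pathVert_ne_pathVert_succ {t : ℕ} (j : Fin r) (ht : t < m j) (hj : 1 < (m j : ℕ)) :
    G.pathVert e m j t ≠ G.pathVert e m j (t + 1) := by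
  unfold pathVert
  intro h
  split_ifs at h <;> simp at h <;> omega

theorem isContraction_subdivideCollapse {g : ℕ} (hG : G.HasGenus g) (he : G.DistinctEdges e) :
    (G.subdivideCollapse e hm hp).IsContraction := by
  have hmi := hm i
  rw [if_pos rfl] at hmi
  have hmpos := (m i).pos
  have hlt : p < m' i := by omega
  refine Hom.isContraction_of_contracts_single_edge (hG.subdivide he m') (hG.subdivide he m) _
    (Sum.inr (⟨i, ⟨p, hlt⟩⟩, true)) ?_ ?_ ?_ ?_
  · exact G.pathVert_ne_pathVert_succ e i hlt (by omega)
  · rintro (u | ⟨j, t⟩)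
    · exact ⟨Sum.inl u, rfl⟩
    · have h1 := hm j
      have h2 := t.2
      -- Inner vertex `t` sits at path position `t + 1`. Its chosen preimage is at position `t + 2`
      -- if it lies beyond the removed edge, and at `t + 1` otherwise.
      have h3 : (if j = i ∧ p ≤ (t : ℕ) then (t : ℕ) + 2 else t + 1) ≤ m' j := by grind
      have h4 : collapsePos i p j (if j = i ∧ p ≤ (t : ℕ) then (t : ℕ) + 2 else t + 1) =
          t + 1 := by
        unfold collapsePos
        grind
      refine ⟨_, (G.subdivideCollapseVert_pathVert e hm hp j h3).trans ?_⟩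
      rw [h4, pathVert_succ]
  · rintro (d | ⟨y, b⟩)
    · refine ⟨Sum.inl d, rfl, ?_⟩
      rintro (d' | ⟨x, b'⟩) h
      · cases h
        rfl
      · obtain ⟨z, -, hz⟩ := Option.map_eq_some_iff.1 h
        cases hz
    · obtain ⟨x, hx, hx'⟩ := existsUnique_collapseSlot (m := fun j => (m j : ℕ))
        (m' := fun j => (m' j : ℕ)) hm hp y
      refine ⟨Sum.inr (x, b), congrArg (Option.map _) hx, ?_⟩
      rintro (d' | ⟨x', b'⟩) h
      · cases h
      · obtain ⟨z, hz, hz'⟩ := Option.map_eq_some_iff.1 h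
        cases hz'
        rw [hx' x' hz]
  · rintro (d | ⟨x, b⟩)
    · constructor
      · intro h
        cases h
      · rintro (h | h) <;> cases h
    · refine Option.map_eq_none_iff.trans ((collapseSlot_eq_none _ _).trans ?_)
      constructor
      · rintro ⟨h1, h2⟩
        obtain ⟨j, t⟩ := x
        dsimp only at h1
        subst h1
        obtain rfl : t = ⟨p, hlt⟩ := Fin.ext h2
        cases b
        · exact Or.inr rfl
        · exact Or.inl rfl
      · rintro (h | h) <;> cases h <;> exact ⟨rfl, rfl⟩

end Subdivide

end CWGraph

/-! ### Sprouting and subdivision as graph families -/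

namespace GraphFamily

variable {g r : ℕ}

theorem eq_add_ite_of_eq_add_single {m m' : Fin r → ℕ} {i : Fin r} (h : m' = m + Pi.single i 1)
    (j : Fin r) : m' j = m j + if j = i then 1 else 0 := by
  rw [h, Pi.add_apply, Pi.single_apply]

theorem collapseSlot_insertAt {m m' : Fin r → ℕ} {i : Fin r}
    (hm : ∀ j, m' j = m j + if j = i then 1 else 0) {p : ℕ} (hp : p ≤ m i) {a : Slot r}
    (ha : (ofLex a).2 < m (ofLex a).1)
    (ha' : (ofLex (Slot.insertAt i p a)).2 < m' (ofLex (Slot.insertAt i p a)).1) :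
    collapseSlot hm hp ⟨(ofLex (Slot.insertAt i p a)).1, ⟨_, ha'⟩⟩ =
      some ⟨(ofLex a).1, ⟨_, ha⟩⟩ :=
  (collapseSlot_eq_some hm hp).2 ⟨rfl, rfl⟩

/-- The family of graphs obtained by sprouting at given vertices. -/
def sprout (G : GenusGraph g) (v : Fin r → G.graph.Vert) : GraphFamily g r where
  Index := Fin r → ℕ
  graph := G.sprout v
  size m := m
  size_injective := fun _ _ h => h
  exists_size_eq_add_single m i := ⟨_, rfl⟩
  V := G.graph.Vert
  E := G.graph.Dart
  finV := inferInstance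
  finE := inferInstance
  vert m u := Sum.inl u
  dart m d := Sum.inl d
  slot m a ha := Sum.inr (⟨(ofLex a).1, ⟨(ofLex a).2, ha⟩⟩, true)
  slot_injective m a b ha hb h := by
    have h := congrArg (fun x => (x.1, (x.2 : ℕ))) (Prod.mk.inj (Sum.inr.inj h)).1
    exact ofLex.injective h
  slot_ne_rev m a b ha hb h := by
    have h := (Prod.mk.inj (Sum.inr.inj h)).2
    cases h
  hom_ext m H φ ψ hv hd hs := by
    -- A slot records only the forward direction of its edge; compatibility with reversal gives the
    -- other one.
    have hs' : ∀ x b, φ.onDart (Sum.inr (x, b)) = ψ.onDart (Sum.inr (x, b)) := by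
      intro x b
      have h := hs (toLex (x.1, (x.2 : ℕ))) x.2.2
      cases b
      · exact (φ.onDart_rev _).trans ((congrArg (Option.map H.rev) h).trans (ψ.onDart_rev _).symm)
      · exact h
    refine CWGraph.Hom.ext (funext ?_) (funext ?_)
    · rintro (u | x)
      · exact hv u
      -- The leaf is the terminus of its edge, whose origin `v x.1` belongs to the fixed part.
      · exact CWGraph.Hom.onVert_tgt_eq (hs' x true) (hv _)
    · rintro (d | ⟨x, b⟩)
      · exact hd d
      · exact hs' x b
  exists_contraction m m' i p h hp := by
    have hm := eq_add_ite_of_eq_add_single h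
    refine ⟨⟨G.graph.sproutCollapse v hm hp,
      G.graph.isContraction_sproutCollapse v hm hp G.hasGenus⟩, fun _ => rfl, fun _ => rfl,
      fun hlt => ?_, fun a ha ha' => ?_⟩
    · exact congrArg (Option.map _) ((collapseSlot_eq_none hm hp).2 ⟨rfl, rfl⟩)
    · exact congrArg (Option.map _) (collapseSlot_insertAt hm hp ha ha')

/-- The family of graphs obtained by subdividing given edges. -/
def subdivide (G : GenusGraph g) (e : Fin r → G.graph.Dart) (he : G.graph.DistinctEdges e) :
    GraphFamily g r where
  Index := Fin r → ℕ+
  graph := G.subdivide e he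
  size m j := m j
  size_injective := fun _ _ h => funext fun j => PNat.coe_injective (congrFun h j)
  exists_size_eq_add_single m i := by
    refine ⟨fun j => ⟨(m j : ℕ) + Pi.single (M := fun _ => ℕ) i 1 j, ?_⟩, rfl⟩
    exact Nat.add_pos_left (m j).pos _
  V := G.graph.Vert
  E := {d : G.graph.Dart // G.graph.Untouched e d}
  finV := inferInstance
  finE := inferInstance
  vert m u := Sum.inl u
  dart m d := Sum.inl d
  slot m a ha := Sum.inr (⟨(ofLex a).1, ⟨(ofLex a).2, ha⟩⟩, true)
  slot_injective m a b ha hb h := by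
    have h := congrArg (fun x => (x.1, (x.2 : ℕ))) (Prod.mk.inj (Sum.inr.inj h)).1
    exact ofLex.injective h
  slot_ne_rev m a b ha hb h := by
    have h := (Prod.mk.inj (Sum.inr.inj h)).2
    cases h
  hom_ext m H φ ψ hv hd hs := by
    have hs' : ∀ x b, φ.onDart (Sum.inr (x, b)) = ψ.onDart (Sum.inr (x, b)) := by
      intro x b
      have h := hs (toLex (x.1, (x.2 : ℕ))) x.2.2
      cases b
      · exact (φ.onDart_rev _).trans ((congrArg (Option.map H.rev) h).trans (ψ.onDart_rev _).symm)
      · exact h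
    -- Inner vertices of a path are reached by walking from its origin, which belongs to the fixed
    -- part.
    have hpath : ∀ (j : Fin r) (t : ℕ), t ≤ m j →
        φ.onVert (G.graph.pathVert e m j t) = ψ.onVert (G.graph.pathVert e m j t) := by
      intro j t
      induction t with
      | zero => exact fun _ => hv _
      | succ t ih =>
        intro ht
        have h := CWGraph.Hom.onVert_tgt_eq (hs' ⟨j, ⟨t, ht⟩⟩ true) (ih (by omega))
        exact h
    refine CWGraph.Hom.ext (funext ?_) (funext ?_)
    · rintro (u | ⟨j, t⟩)
      · exact hv u
      · have := hpath j (t + 1) (by omega)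
        rwa [CWGraph.pathVert_succ] at this
    · rintro (d | ⟨x, b⟩)
      · exact hd d
      · exact hs' x b
  exists_contraction m m' i p h hp := by
    have hm := eq_add_ite_of_eq_add_single h
    refine ⟨⟨G.graph.subdivideCollapse e hm hp,
      G.graph.isContraction_subdivideCollapse e hm hp G.hasGenus he⟩, fun _ => rfl, fun _ => rfl,
      fun hlt => ?_, fun a ha ha' => ?_⟩
    · exact congrArg (Option.map _) ((collapseSlot_eq_none hm hp).2 ⟨rfl, rfl⟩)
    · exact congrArg (Option.map _) (collapseSlot_insertAt hm hp ha ha')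

end GraphFamily

theorem mainTheorem8 {k : Type u} [Field k] {g d : ℕ} (M : GraphModule k g)
    (hM : M.IsSmallish d) (G : GenusGraph g) (r : ℕ) :
    (∀ (e : Fin r → G.graph.Dart) (he : G.graph.DistinctEdges e)
      (_ : ∀ i, G.graph.src (e i) ≠ G.graph.tgt (e i)),
      ∃ f : MvPolynomial (Fin r) ℚ, f.totalDegree ≤ d ∧
        ∃ N : ℕ, ∀ m : Fin r → ℕ+, (∀ i, N ≤ m i) →
          Module.Finite k (M.obj (op (G.subdivide e he m))) ∧
          (Module.finrank k (M.obj (op (G.subdivide e he m))) : ℚ) =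
            MvPolynomial.eval (fun i => ((m i : ℕ) : ℚ)) f) ∧
    (∀ v : Fin r → G.graph.Vert, Function.Injective v →
      ∃ f : MvPolynomial (Fin r) ℚ, f.totalDegree ≤ d ∧
        ∃ N : ℕ, ∀ m : Fin r → ℕ, (∀ i, N ≤ m i) →
          Module.Finite k (M.obj (op (G.sprout v m))) ∧
          (Module.finrank k (M.obj (op (G.sprout v m))) : ℚ) =
            MvPolynomial.eval (fun i => (m i : ℚ)) f) :=
  ⟨fun e he _ => (GraphFamily.subdivide G e he).exists_polynomial hM,
    fun v _ => (GraphFamily.sprout G v).exists_polynomial hM⟩
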